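/- Let $\Omega$ be a Hausdorff space and $\mathcal B$ a $\sigma$-algebra on $\Omega$ containing the Borel sets. Let $\mathcal M$ be the set of finite, non-zero measures on $\mathcal B$ that are inner regular with respect to compact sets. Measures are compared setwise on $\mathcal B$, and $\operatorname{supp}\mu$ is the complement of the union of all open $\mu$-null sets. **Clustering base.** Let $\mathcal A\subset\mathcal B$ be a class of closed non-empty sets. An *$\mathcal A$-separation relation* is a symmetric relation $\perp$ on $\mathcal B$ such that (i) $B\perp B$ implies $B=\emptyset$; (ii) $A\subset A'$ and $A'\perp B$ imply $A\perp B$; (iii) if $A\in\mathcal A$ and $A\subset B_1\cup\dots\cup B_k$ with $B_1,\dots,B_k\in\mathcal B$ closed and $B_i\perp B_j$ for $i\neq j$, then $A\subset B_i$ for some $i$. It is *stable* if for all $A_1\subset A_2\subset\cdots$ in $\mathcal A$ and $B\in\mathcal B$ with $A_n\perp B$ for all $n$ we have $\bigcup_nA_n\perp B$. A (stable) *clustering base* is a triple $(\mathcal A,\mathcal Q,\perp)$ where $\perp$ is a (stable) $\mathcal A$-separation relation and $\mathcal Q=\{Q_A\}_{A\in\mathcal A}\subset\mathcal M$ is a family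 of probability measures such that $\operatorname{supp}Q_A=A$ for all $A\in\mathcal A$, and for all $A\subset A'$ in $\mathcal A$ either $Q_{A'}(A)=0$ or $Q_A(\cdot)=Q_{A'}(\cdot\cap A)/Q_{A'}(A)$. A *base measure on $A\in\mathcal A$* is a measure $\alpha Q_A$ with $0<\alpha<\infty$. For $P\in\mathcal M$ and $B\in\mathcal B$ let $\mathcal Q_P(B)$ be the set of base measures $\alpha Q_A\le P$ with $B\subset A$. The base is *$P$-subadditive* if for all base measures $\mathsf a,\mathsf a'\le P$ on $A,A'$ with $P(A\cap A')>0$ there is $\mathsf b\in\mathcal Q_P(A\cup A')$ with $\mathsf b\ge\mathsf a$ or $\mathsf b\ge\mathsf a'$. **Forests.** A *$\perp$-forest* is a non-empty set $F$ of non-empty sets in $\mathcal B$ such that for all $A,A'\in F$ we have $A\perp A'$, $A\subset A'$ or $A'\subset A$. For $A\in F$ put $F_{>A}=\{A'\in F: A\subsetneq A'\}$; $A$ is a *root* if $F_{>A}=\emptyset$; *direct siblings* are two distinct $A_1,A_2\in F$ with $F_{>A_1}=F_{>A_2}$, and a minimal element of this set is then a *direct parent* of them. The *structure* $s(F)$ consists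 of all $A\in F$ that are roots or have a direct sibling in $F$; $F$ is *structured* if $s(F)=F$. A *graph isomorphism* $\zeta:F\to F'$ is a bijection with $A\subset A'\iff\zeta(A)\subset\zeta(A')$ for all $A,A'\in F$. For finite forests write $F\le F'$ if there is a graph isomorphism $\zeta:F\to F'$ with $A\subset\zeta(A)$ for all $A\in F$; this $\zeta$ is then unique. If $(F_n)_{n\ge1}$ are finite forests with $s(F_1)\le s(F_2)\le\cdots$, and $\zeta_n:s(F_1)\to s(F_n)$ is the unique such map, define $$\lim_n s(F_n):=\Big\{\bigcup_{n\ge1}\zeta_n(A): A\in s(F_1)\Big\}.$$ **Adapted isomonotone sequences.** A measure $Q$ is *simple* on a finite $\perp$-forest $F\subset\mathcal A$ if $Q=\sum_{A\in F}\alpha_AQ_A$ with all $\alpha_A>0$ (the $\alpha_A$ are then unique); the *level* of $A\in F$ is $\lambda_Q(A)=\big(\sum_{A'\in F,\,A'\supset A}\alpha_{A'}Q_{A'}(A)\big)Q_A$. It is *$P$-adapted* if all direct siblings $A_1,A_2$ in $F$ satisfy: (a) if $\mathcal Q_P(A_1\cup A_2)\neq\emptyset$, then $A_1,A_2$ have a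 direct parent in $F$; (b) for every $\mathsf b\in\mathcal Q_P(A_1\cup A_2)$ there is $\tilde{\mathsf b}\in\mathcal Q_P(\bigcup\{A\in F:F_{>A}=F_{>A_1}\})$ with $\tilde{\mathsf b}\ge\mathsf b$; (c) there is $\alpha\in(0,1)$ such that no $\mathsf b\in\mathcal Q_P(A_1\cup A_2)$ satisfies $\mathsf b\ge\alpha\lambda_Q(A_1)$ or $\mathsf b\ge\alpha\lambda_Q(A_2)$. An *adapted isomonotone sequence* $(Q_n,F_n)\uparrow P$ consists of $P$-adapted simple measures $Q_n$ on finite $\perp$-forests $F_n\subset\mathcal A$, $n\ge1$, with $Q_1\le Q_2\le\cdots\le P$, $Q_n(B)\to P(B)$ for all $B\in\mathcal B$, and $s(F_1)\le s(F_2)\le\cdots$. **Theorem.** Let $(\mathcal A,\mathcal Q,\perp)$ be a stable clustering base and let $P\in\mathcal M$ be such that the base is $P$-subadditive. If $(Q_n,F_n)\uparrow P$ and $(Q_n',F_n')\uparrow P$ are adapted isomonotone sequences, then $F_\infty:=\lim_n s(F_n)$ and $F_\infty':=\lim_n s(F_n')$ are finite structured $\perp$-forests and $F_\infty=_PF'_\infty$,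 that is, there is a graph isomorphism $\zeta:F_\infty\to F_\infty'$ with $P(A\,\triangle\,\zeta(A))=0$ for all $A\in F_\infty$. -/

import Mathlib

open Set Filter MeasureTheory
open scoped Topology NNReal ENNReal

noncomputable section

namespace Clustering

variable {Ω : Type*}

/-! ### Set-valued forests (order-theoretic notions) -/

/-- `F` is a `𝒞`-valued `⊥`-forest. -/
structure IsForest (𝒞 : Set (Set Ω)) (perp : Set Ω → Set Ω → Prop) (F : Set (Set Ω)) : Prop where
  nonempty : F.Nonempty
  subset : F ⊆ 𝒞
  separated : ∀ A ∈ F, ∀ A' ∈ F, perp A A' ∨ A ⊆ A' ∨ A' ⊆ A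

/-- The chain `F_{>A}` of strict ancestors of `A` in `F`. -/
def strictAncestors (F : Set (Set Ω)) (A : Set Ω) : Set (Set Ω) := {A' | A' ∈ F ∧ A ⊂ A'}

/-- `A` is a root (maximal element) of `F`. -/
def IsRoot (F : Set (Set Ω)) (A : Set Ω) : Prop := A ∈ F ∧ ¬ ∃ A' ∈ F, A ⊂ A'

/-- `A₁, A₂` are direct siblings in `F`: distinct nodes with the same strict ancestors.
In particular two distinct roots are direct siblings. -/
def DirectSiblings (F : Set (Set Ω)) (A₁ A₂ : Set Ω) : Prop :=
  A₁ ∈ F ∧ A₂ ∈ F ∧ A₁ ≠ A₂ ∧ strictAncestors F A₁ = strictAncestors F A₂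

/-- `A'` is a direct parent of `A` in `F`: a minimal element of `F_{>A}`. -/
def IsDirectParent (F : Set (Set Ω)) (A' A : Set Ω) : Prop :=
  A' ∈ strictAncestors F A ∧ ¬ ∃ A'' ∈ strictAncestors F A, A'' ⊂ A'

/-- The structure `s(F)` of a forest. -/
def struct (F : Set (Set Ω)) : Set (Set Ω) :=
  {A | A ∈ F ∧ (IsRoot F A ∨ ∃ A', DirectSiblings F A A')}

/-- `ζ` is a graph isomorphism from `F` onto `F'` (only its values on `F` matter). -/
structure IsForestIso (F F' : Set (Set Ω)) (ζ : Set Ω → Set Ω) : Prop where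
  bijOn : BijOn ζ F F'
  subset_iff : ∀ A ∈ F, ∀ A' ∈ F, A ⊆ A' ↔ ζ A ⊆ ζ A'

/-- `ζ` is a forest relating map from `F` to `F'`. -/
structure IsFRM (F F' : Set (Set Ω)) (ζ : Set Ω → Set Ω) : Prop extends IsForestIso F F' ζ where
  subset_map : ∀ A ∈ F, A ⊆ ζ A

/-- The relation `F ≤ F'` between forests. -/
def ForestLE (F F' : Set (Set Ω)) : Prop := ∃ ζ, IsFRM F F' ζ

/-- A forest relating map between finite forests is unique, so that `frm` below is well defined. -/
theorem IsFRM.unique {F F' : Set (Set Ω)} {ζ ξ : Set Ω → Set Ω} (hF : F.Finite)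
    (hne : ∀ A ∈ F, A.Nonempty)
    (hF' : ∀ A ∈ F', ∀ A' ∈ F', Disjoint A A' ∨ A ⊆ A' ∨ A' ⊆ A)
    (hζ : IsFRM F F' ζ) (hξ : IsFRM F F' ξ) {A : Set Ω} (hA : A ∈ F) : ζ A = ξ A := by
  have hfin : F'.Finite := hζ.bijOn.image_eq ▸ hF.image ζ
  have key : ∀ η : Set Ω → Set Ω, IsFRM F F' η →
      {X | X ∈ F' ∧ X ⊆ η A}.ncard = {X | X ∈ F ∧ X ⊆ A}.ncard := by
    intro η hη
    have : {X | X ∈ F' ∧ X ⊆ η A} = η '' {X | X ∈ F ∧ X ⊆ A} := by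
      ext X
      constructor
      · rintro ⟨hX, hXA⟩
        obtain ⟨Y, hY, rfl⟩ := hη.bijOn.surjOn hX
        exact ⟨Y, ⟨hY, (hη.subset_iff Y hY A hA).2 hXA⟩, rfl⟩
      · rintro ⟨Y, ⟨hY, hYA⟩, rfl⟩
        exact ⟨hη.bijOn.mapsTo hY, (hη.subset_iff Y hY A hA).1 hYA⟩
    rw [this]
    exact InjOn.ncard_image (hη.bijOn.injOn.mono fun X hX => hX.1)
  have aux : ∀ η θ : Set Ω → Set Ω, IsFRM F F' η → IsFRM F F' θ → η A ⊆ θ A → θ A ⊆ η A := by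
    intro η θ hη hθ hsub
    have hincl : {X | X ∈ F' ∧ X ⊆ η A} ⊆ {X | X ∈ F' ∧ X ⊆ θ A} :=
      fun X hX => ⟨hX.1, hX.2.trans hsub⟩
    have heq := eq_of_subset_of_ncard_le hincl (by rw [key η hη, key θ hθ])
      (hfin.subset fun X hX => hX.1)
    have hmem : θ A ∈ {X | X ∈ F' ∧ X ⊆ θ A} := ⟨hθ.bijOn.mapsTo hA, Subset.rfl⟩
    rw [← heq] at hmem
    exact hmem.2
  rcases hF' _ (hζ.bijOn.mapsTo hA) _ (hξ.bijOn.mapsTo hA) with h | h | h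
  · obtain ⟨x, hx⟩ := hne A hA
    exact absurd (hξ.subset_map A hA hx) (disjoint_left.1 h (hζ.subset_map A hA hx))
  · exact h.antisymm (aux ζ ξ hζ hξ h)
  · exact (aux ξ ζ hξ hζ h).antisymm h

open Classical in
/-- The forest relating map from `F` to `F'` when `F ≤ F'`. -/
def frm (F F' : Set (Set Ω)) : Set Ω → Set Ω :=
  if h : ForestLE F F' then h.choose else id

/-- The limit `lim_n s(F_n) = {⋃ n, ζ_n(A) | A ∈ s(F_0)}` of an isomonotone sequence of forests,
where `ζ_n : s(F_0) → s(F_n)` is the forest relating map. -/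
def limitForest (F : ℕ → Set (Set Ω)) : Set (Set Ω) :=
  {B | ∃ A ∈ struct (F 0), B = ⋃ n, frm (struct (F 0)) (struct (F n)) A}

variable [TopologicalSpace Ω] [MeasurableSpace Ω]

/-! ### Clustering bases -/

/-- `P` belongs to the class `ℳ_Ω` of finite, non-zero, inner regular measures. -/
structure MemM (P : Measure Ω) : Prop where
  finite : IsFiniteMeasure P
  ne_zero : P ≠ 0
  innerRegular : P.InnerRegular

/-- `perp` is an `𝒜`-separation relation. The relation is only relevant on measurable sets. -/
structure IsSeparationRelation (𝒜 : Set (Set Ω)) (perp : Set Ω → Set Ω → Prop) : Prop where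
  base_measurable : ∀ A ∈ 𝒜, MeasurableSet A
  base_closed : ∀ A ∈ 𝒜, IsClosed A
  base_nonempty : ∀ A ∈ 𝒜, A.Nonempty
  symm : ∀ B B', MeasurableSet B → MeasurableSet B' → perp B B' → perp B' B
  reflexivity : ∀ B, MeasurableSet B → perp B B → B = ∅
  monotonicity : ∀ A A' B, MeasurableSet A → MeasurableSet A' → MeasurableSet B →
    A ⊆ A' → perp A' B → perp A B
  connectedness : ∀ A ∈ 𝒜, ∀ (k : ℕ) (B : Fin k → Set Ω),
    (∀ i, MeasurableSet (B i)) → (∀ i, IsClosed (B i)) →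
    (∀ i j, i ≠ j → perp (B i) (B j)) → A ⊆ ⋃ i, B i → ∃ i, A ⊆ B i

/-- Stability of a separation relation. -/
def IsStable (𝒜 : Set (Set Ω)) (perp : Set Ω → Set Ω → Prop) : Prop :=
  ∀ A : ℕ → Set Ω, (∀ n, A n ∈ 𝒜) → (∀ n, A n ⊆ A (n + 1)) →
    ∀ B, MeasurableSet B → (∀ n, perp (A n) B) → perp (⋃ n, A n) B

/-- `(𝒜, {𝒬_A}_{A ∈ 𝒜}, perp)` is a clustering base (only the values `𝒬 A` for `A ∈ 𝒜` matter). -/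
structure IsClusteringBase (𝒜 : Set (Set Ω)) (𝒬 : Set Ω → Measure Ω)
    (perp : Set Ω → Set Ω → Prop) : Prop where
  separation : IsSeparationRelation 𝒜 perp
  memM : ∀ A ∈ 𝒜, MemM (𝒬 A)
  prob : ∀ A ∈ 𝒜, IsProbabilityMeasure (𝒬 A)
  flatness : ∀ A ∈ 𝒜, ∀ A' ∈ 𝒜, A ⊆ A' →
    𝒬 A' A = 0 ∨ ∀ B, MeasurableSet B → 𝒬 A B = 𝒬 A' (B ∩ A) / 𝒬 A' A
  fittedness : ∀ A ∈ 𝒜, A = (𝒬 A).support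

/-- `b` is a base measure on `A`. -/
def IsBaseMeasureOn (𝒜 : Set (Set Ω)) (𝒬 : Set Ω → Measure Ω) (b : Measure Ω) (A : Set Ω) : Prop :=
  A ∈ 𝒜 ∧ ∃ r : ℝ≥0, 0 < r ∧ b = r • 𝒬 A

/-- The set `𝒬_P(B)` of all base measures below `P` whose base set contains `B`. -/
def baseBelow (𝒜 : Set (Set Ω)) (𝒬 : Set Ω → Measure Ω) (P : Measure Ω) (B : Set Ω) :
    Set (Measure Ω) :=
  {b | ∃ A, IsBaseMeasureOn 𝒜 𝒬 b A ∧ B ⊆ A ∧ b ≤ P}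

/-- `P`-subadditivity of a clustering base. -/
def IsSubadditive (𝒜 : Set (Set Ω)) (𝒬 : Set Ω → Measure Ω) (P : Measure Ω) : Prop :=
  ∀ a a' A A', IsBaseMeasureOn 𝒜 𝒬 a A → IsBaseMeasureOn 𝒜 𝒬 a' A' → a ≤ P → a' ≤ P →
    0 < P (A ∩ A') → ∃ b ∈ baseBelow 𝒜 𝒬 P (A ∪ A'), a ≤ b ∨ a' ≤ b

/-! ### Simple and adapted measures -/

/-- `Q` is simple on the finite `𝒜`-valued `⊥`-forest `F`, with representation
`Q = ∑ A ∈ F, c A • 𝒬 A` and all `c A > 0`. -/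
structure IsSimpleRep (𝒜 : Set (Set Ω)) (𝒬 : Set Ω → Measure Ω) (perp : Set Ω → Set Ω → Prop)
    (Q : Measure Ω) (F : Finset (Set Ω)) (c : Set Ω → ℝ≥0) : Prop where
  forest : IsForest 𝒜 perp (F : Set (Set Ω))
  pos : ∀ A ∈ F, 0 < c A
  eq_sum : Q = ∑ A ∈ F, c A • 𝒬 A

/-- `Q` is a simple measure on the forest `F`. -/
def IsSimpleOn (𝒜 : Set (Set Ω)) (𝒬 : Set Ω → Measure Ω) (perp : Set Ω → Set Ω → Prop)
    (Q : Measure Ω) (F : Finset (Set Ω)) : Prop :=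
  ∃ c, IsSimpleRep 𝒜 𝒬 perp Q F c

open Classical in
/-- The level of `A` in the simple measure `∑ A ∈ F, c A • 𝒬 A`. -/
def level (𝒬 : Set Ω → Measure Ω) (F : Finset (Set Ω)) (c : Set Ω → ℝ≥0) (A : Set Ω) :
    Measure Ω :=
  (∑ A' ∈ F.filter (fun A' => A ⊆ A'), (c A' : ℝ≥0∞) * 𝒬 A' A) • 𝒬 A

/-- Siblings which are kin below `P` have a parent. -/
def Grounded (𝒜 : Set (Set Ω)) (𝒬 : Set Ω → Measure Ω) (P : Measure Ω) (F : Set (Set Ω))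
    (A₁ A₂ : Set Ω) : Prop :=
  (baseBelow 𝒜 𝒬 P (A₁ ∪ A₂)).Nonempty → ∃ A', IsDirectParent F A' A₁ ∧ IsDirectParent F A' A₂

/-- Every base measure supporting `A₁, A₂` below `P` is majorized by one that supports all nodes
with the same strict ancestors, that is `A₁`, `A₂` and all their direct siblings. -/
def Fine (𝒜 : Set (Set Ω)) (𝒬 : Set Ω → Measure Ω) (P : Measure Ω) (F : Set (Set Ω))
    (A₁ A₂ : Set Ω) : Prop :=
  ∀ b ∈ baseBelow 𝒜 𝒬 P (A₁ ∪ A₂),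
    ∃ b' ∈ baseBelow 𝒜 𝒬 P (⋃₀ {A | A ∈ F ∧ strictAncestors F A = strictAncestors F A₁}), b ≤ b'

/-- Strict motivation of two measures `a₁, a₂` (the levels of `A₁, A₂`). -/
def StrictlyMotivated (𝒜 : Set (Set Ω)) (𝒬 : Set Ω → Measure Ω) (P : Measure Ω)
    (A₁ A₂ : Set Ω) (a₁ a₂ : Measure Ω) : Prop :=
  ∃ t : ℝ≥0, 0 < t ∧ t < 1 ∧
    ∀ b B, IsBaseMeasureOn 𝒜 𝒬 b B → (t • a₁ ≤ b ∨ t • a₂ ≤ b) → b ∉ baseBelow 𝒜 𝒬 P (A₁ ∪ A₂)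

/-- The simple measure `Q` on `F` is `P`-adapted. The representing coefficients `c` are uniquely
determined by `Q` for a clustering base, so their existential quantification is immaterial. -/
def IsAdapted (𝒜 : Set (Set Ω)) (𝒬 : Set Ω → Measure Ω) (perp : Set Ω → Set Ω → Prop)
    (P Q : Measure Ω) (F : Finset (Set Ω)) : Prop :=
  ∃ c, IsSimpleRep 𝒜 𝒬 perp Q F c ∧
    ∀ A₁ A₂, DirectSiblings (F : Set (Set Ω)) A₁ A₂ →
      Grounded 𝒜 𝒬 P F A₁ A₂ ∧ Fine 𝒜 𝒬 P F A₁ A₂ ∧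
      StrictlyMotivated 𝒜 𝒬 P A₁ A₂ (level 𝒬 F c A₁) (level 𝒬 F c A₂)

/-- Isomonotone convergence `(Q_n, F_n) ↑ P`. -/
structure IsomonotoneConv (𝒜 : Set (Set Ω)) (𝒬 : Set Ω → Measure Ω) (perp : Set Ω → Set Ω → Prop)
    (Q : ℕ → Measure Ω) (F : ℕ → Finset (Set Ω)) (P : Measure Ω) : Prop where
  simple : ∀ n, IsSimpleOn 𝒜 𝒬 perp (Q n) (F n)
  mono : ∀ n, Q n ≤ Q (n + 1)
  le : ∀ n, Q n ≤ P
  tendsto : ∀ B, MeasurableSet B → Tendsto (fun n => Q n B) atTop (𝓝 (P B))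
  struct_le : ∀ n, ForestLE (struct (F n : Set (Set Ω))) (struct (F (n + 1) : Set (Set Ω)))

/-- `(Q_n, F_n) ↑ P` is an adapted isomonotone sequence. -/
def AdaptedIsomonotoneConv (𝒜 : Set (Set Ω)) (𝒬 : Set Ω → Measure Ω)
    (perp : Set Ω → Set Ω → Prop) (Q : ℕ → Measure Ω) (F : ℕ → Finset (Set Ω))
    (P : Measure Ω) : Prop :=
  IsomonotoneConv 𝒜 𝒬 perp Q F P ∧ ∀ n, IsAdapted 𝒜 𝒬 perp P (Q n) (F n)

/-- `F` is a finite structured `⊥`-forest of non-empty measurable sets. -/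
def IsFiniteStructuredForest (perp : Set Ω → Set Ω → Prop) (F : Set (Set Ω)) : Prop :=
  F.Finite ∧ IsForest {B : Set Ω | MeasurableSet B ∧ B.Nonempty} perp F ∧ struct F = F

/-- `F₁ =_P F₂`: there is a graph isomorphism moving each node only by a `P`-null set. -/
def ForestEq (P : Measure Ω) (F₁ F₂ : Set (Set Ω)) : Prop :=
  ∃ ζ, IsForestIso F₁ F₂ ζ ∧ ∀ A ∈ F₁, P (symmDiff A (ζ A)) = 0

end Clustering

end

open Clustering

/-! Index each sequence by its first structure `struct (F 0)`, follow an index i through its nodes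
`T n i`, and call their union over n a limit node. It suffices to find, for every limit node of
either sequence, one of the other that agrees with it up to a `P`-null set: among the limit nodes of
one sequence, inclusion modulo null sets is genuine inclusion
(`IsAdaptedTower.subset_of_measure_diff`), so such a matching is automatically a graph isomorphism
(`forestEq_of_exists`).

The engine is flatness. On the smaller of two nested base sets, one base measure is a multiple
(possibly zero) of the other, so domination on one non-null piece spreads to the whole base set
(`IsBaseMeasureOn.smul_le`). Since `Q n` exhausts `P`, a base measure a ≤ `P` inside a limit node is
eventually almost dominated, on a piece that a charges, by the level of a single node
(`IsAdaptedTower.eventually_exists_level_ge`).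

Let K, K' be siblings of one forest lying, up to null sets, in the limit node k of the other
sequence. Strict motivation forbids a base measure below `P` to support both and almost dominate one
of their levels, while subadditivity merges base measures that overlap. Together they force the
nodes approximating K and K' apart, hence into children of k; fineness prevents K from spreading
over several children. So K lies almost in one child of k
(`IsMotivatedPair.exists_child_measure_diff`). For roots, groundedness plays this role.

The matching then descends from the roots. Going to the other sequence and back puts i inside some
i₂ that is again a root, or a child of the same parent, so i = i₂ and both inclusions are equalities
modulo `P`. Stability serves to carry separation over to the limit nodes. -/

noncomputable section

namespace Clustering

/-! ### Finite laminar families -/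

section Laminar

variable {Ω : Type*}

/-- Non-empty sets any two of which are disjoint or nested. -/
structure IsLaminar (F : Set (Set Ω)) : Prop where
  nonempty : ∀ A ∈ F, A.Nonempty
  cases : ∀ A ∈ F, ∀ B ∈ F, Disjoint A B ∨ A ⊆ B ∨ B ⊆ A

/-- `B` is the smallest member of `G` strictly above `A`. -/
structure IsChild (G : Set (Set Ω)) (A B : Set Ω) : Prop where
  mem : A ∈ G
  parent_mem : B ∈ G
  ssubset : A ⊂ B
  le_of_ssubset : ∀ E ∈ G, A ⊂ E → B ⊆ E

theorem IsLaminar.mono {F G : Set (Set Ω)} (hF : IsLaminar F) (h : G ⊆ F) : IsLaminar G :=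
  ⟨fun A hA => hF.nonempty A (h hA), fun A hA B hB => hF.cases A (h hA) B (h hB)⟩

theorem IsLaminar.comparable {F : Set (Set Ω)} (hF : IsLaminar F) {A B X : Set Ω}
    (hA : A ∈ F) (hB : B ∈ F) (hX : X.Nonempty) (hXA : X ⊆ A) (hXB : X ⊆ B) :
    A ⊆ B ∨ B ⊆ A := by
  rcases hF.cases A hA B hB with h | h
  · obtain ⟨x, hx⟩ := hX
    exact absurd (hXB hx) (disjoint_left.1 h (hXA hx))
  · exact h

theorem struct_subset (F : Set (Set Ω)) : struct F ⊆ F := fun _ h => h.1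

theorem DirectSiblings.symm {F : Set (Set Ω)} {A B : Set Ω} (h : DirectSiblings F A B) :
    DirectSiblings F B A := ⟨h.2.1, h.1, h.2.2.1.symm, h.2.2.2.symm⟩

theorem DirectSiblings.left_mem_struct {F : Set (Set Ω)} {A B : Set Ω}
    (h : DirectSiblings F A B) : A ∈ struct F := ⟨h.1, Or.inr ⟨B, h⟩⟩

theorem DirectSiblings.ssubset_iff {F : Set (Set Ω)} {A B E : Set Ω}
    (h : DirectSiblings F A B) (hE : E ∈ F) : A ⊂ E ↔ B ⊂ E := by
  have := Set.ext_iff.1 h.2.2.2 E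
  simpa [strictAncestors, hE] using this

/-- A direct sibling of a structure node is itself in the structure, and discarding other nodes
removes the same ancestors from both. -/
theorem struct_struct (F : Set (Set Ω)) : struct (struct F) = struct F := by
  refine (struct_subset _).antisymm fun A hA => ⟨hA, ?_⟩
  rcases hA.2 with h | ⟨B, h⟩
  · exact Or.inl ⟨hA, fun ⟨E, hE, hAE⟩ => h.2 ⟨E, hE.1, hAE⟩⟩
  · refine Or.inr ⟨B, hA, h.symm.left_mem_struct, h.2.2.1, ?_⟩
    ext E
    exact ⟨fun hE => ⟨hE.1, (h.ssubset_iff hE.1.1).1 hE.2⟩,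
      fun hE => ⟨hE.1, (h.ssubset_iff hE.1.1).2 hE.2⟩⟩

theorem exists_maximal_superset {F : Set (Set Ω)} (hfin : F.Finite) (p : Set Ω → Prop)
    {X : Set Ω} (hX : X ∈ F) (hp : p X) :
    ∃ E ∈ F, p E ∧ X ⊆ E ∧ ∀ G ∈ F, p G → E ⊂ G → False := by
  obtain ⟨E, hXE, hE⟩ := (hfin.subset (sep_subset F p)).exists_le_maximal ⟨hX, hp⟩
  exact ⟨E, hE.prop.1, hE.prop.2, hXE, fun G hG hpG hEG => hEG.2 (hE.2 ⟨hG, hpG⟩ hEG.1)⟩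

/-- Take the largest member above X not containing Y, and the largest above Y not containing X. The
strict ancestors of either are exactly the members containing both X and Y. -/
theorem IsLaminar.exists_directSiblings {F : Set (Set Ω)} (hF : IsLaminar F) (hfin : F.Finite)
    {X Y : Set Ω} (hX : X ∈ F) (hY : Y ∈ F) (hXY : Disjoint X Y) :
    ∃ X' Y', DirectSiblings F X' Y' ∧ X ⊆ X' ∧ Y ⊆ Y' ∧
      ∀ Z ∈ F, X ⊆ Z → Y ⊆ Z → X' ⊂ Z ∧ Y' ⊂ Z := by
  have hnX := hF.nonempty X hX
  have hnY := hF.nonempty Y hY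
  have hYX : ¬ Y ⊆ X := fun h => hnY.ne_empty (hXY.symm.eq_bot_of_le h)
  have hXY' : ¬ X ⊆ Y := fun h => hnX.ne_empty (hXY.eq_bot_of_le h)
  obtain ⟨X', hX', hYX', hXX', hmX⟩ := exists_maximal_superset hfin (fun E => ¬ Y ⊆ E) hX hYX
  obtain ⟨Y', hY', hXY'', hYY', hmY⟩ := exists_maximal_superset hfin (fun E => ¬ X ⊆ E) hY hXY'
  have key : ∀ Z ∈ F, X ⊆ Z → Y ⊆ Z → X' ⊂ Z ∧ Y' ⊂ Z := by
    intro Z hZ hXZ hYZ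
    constructor
    · rcases hF.comparable hX' hZ hnX hXX' hXZ with h | h
      · exact ⟨h, fun h' => hYX' (hYZ.trans h')⟩
      · exact absurd (hYZ.trans h) hYX'
    · rcases hF.comparable hY' hZ hnY hYY' hYZ with h | h
      · exact ⟨h, fun h' => hXY'' (hXZ.trans h')⟩
      · exact absurd (hXZ.trans h) hXY''
  refine ⟨X', Y', ⟨hX', hY', ?_, ?_⟩, hXX', hYY', key⟩
  · rintro rfl
    exact hXY'' hXX'
  · ext Z
    constructor
    · rintro ⟨hZ, hlt⟩
      have : Y ⊆ Z := by_contra fun h => hmX Z hZ h hlt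
      exact ⟨hZ, (key Z hZ (hXX'.trans hlt.1) this).2⟩
    · rintro ⟨hZ, hlt⟩
      have : X ⊆ Z := by_contra fun h => hmY Z hZ h hlt
      exact ⟨hZ, (key Z hZ this (hYY'.trans hlt.1)).1⟩

theorem IsLaminar.exists_child_superset {G : Set (Set Ω)} (hG : IsLaminar G) (hfin : G.Finite)
    {A B : Set Ω} (hA : A ∈ G) (hB : B ∈ G) (hAB : A ⊂ B) : ∃ K, IsChild G K B ∧ A ⊆ K := by
  obtain ⟨K, hK, hKB, hAK, hm⟩ := exists_maximal_superset hfin (fun E => E ⊂ B) hA hAB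
  refine ⟨K, ⟨hK, hB, hKB, fun E hE hKE => ?_⟩, hAK⟩
  rcases hG.comparable hB hE (hG.nonempty K hK) hKB.1 hKE.1 with h | h
  · exact h
  · by_contra h'
    exact hm E hE ⟨h, h'⟩ hKE

theorem IsLaminar.exists_parent {G : Set (Set Ω)} (hG : IsLaminar G) (hfin : G.Finite)
    {A : Set Ω} (hA : A ∈ G) (hr : ¬ IsRoot G A) : ∃ B, IsChild G A B := by
  have : ∃ E ∈ G, A ⊂ E := by
    by_contra h
    exact hr ⟨hA, h⟩
  obtain ⟨E, hE, hAE⟩ := this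
  obtain ⟨B, hB⟩ := (hfin.subset (sep_subset G fun E => A ⊂ E)).exists_minimal ⟨E, hE, hAE⟩
  refine ⟨B, hA, hB.prop.1, hB.prop.2, fun D hD hAD => ?_⟩
  rcases hG.comparable hB.prop.1 hD (hG.nonempty A hA) hB.prop.2.1 hAD.1 with h | h
  · exact h
  · exact hB.2 ⟨hD, hAD⟩ h

theorem IsLaminar.exists_root_superset {G : Set (Set Ω)} (hfin : G.Finite)
    {A : Set Ω} (hA : A ∈ G) : ∃ R, IsRoot G R ∧ A ⊆ R := by
  obtain ⟨R, hR, -, hAR, hm⟩ := exists_maximal_superset hfin (fun _ => True) hA trivial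
  exact ⟨R, ⟨hR, fun ⟨E, hE, h⟩ => hm E hE trivial h⟩, hAR⟩

theorem IsChild.disjoint {G : Set (Set Ω)} (hG : IsLaminar G) {K K' B : Set Ω}
    (h : IsChild G K B) (h' : IsChild G K' B) (hne : K ≠ K') : Disjoint K K' := by
  rcases hG.cases K h.mem K' h'.mem with hd | hd | hd
  · exact hd
  · exact absurd (h.le_of_ssubset K' h'.mem (hd.ssubset_of_ne hne)) h'.ssubset.2
  · exact absurd (h'.le_of_ssubset K h.mem (hd.ssubset_of_ne hne.symm)) h.ssubset.2

theorem IsRoot.mem_struct {F : Set (Set Ω)} {A : Set Ω} (h : IsRoot F A) : A ∈ struct F :=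
  ⟨h.1, Or.inl h⟩

theorem IsRoot.directSiblings {F : Set (Set Ω)} {A B : Set Ω} (hA : IsRoot F A)
    (hB : IsRoot F B) (hne : A ≠ B) : DirectSiblings F A B := by
  refine ⟨hA.1, hB.1, hne, ?_⟩
  ext E
  exact ⟨fun h => absurd ⟨E, h⟩ hA.2, fun h => absurd ⟨E, h⟩ hB.2⟩

theorem isRoot_struct_iff {F : Set (Set Ω)} (hfin : F.Finite) {A : Set Ω} :
    IsRoot (struct F) A ↔ IsRoot F A := by
  constructor
  · intro h
    obtain ⟨R, hR, hAR⟩ := IsLaminar.exists_root_superset hfin h.1.1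
    by_cases hE : A = R
    · rwa [hE]
    · exact absurd ⟨R, hR.mem_struct, hAR.ssubset_of_ne hE⟩ h.2
  · intro h
    exact ⟨h.mem_struct, fun ⟨E, hE, hAE⟩ => h.2 ⟨E, hE.1, hAE⟩⟩

/-- The adaptedness conditions concern siblings in the full forest, whereas limits only see its
structure. No discarded node can come between: the sibling pair above K and K' strictly inside B
belongs to the structure, so it is K, K' itself. -/
theorem IsChild.directSiblings {F : Set (Set Ω)} (hF : IsLaminar F) (hfin : F.Finite)
    {K K' B : Set Ω} (h : IsChild (struct F) K B) (h' : IsChild (struct F) K' B) (hne : K ≠ K') :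
    DirectSiblings F K K' := by
  have hd := h.disjoint (hF.mono (struct_subset F)) h' hne
  obtain ⟨X, Y, hXY, hX, hY, hZ⟩ := hF.exists_directSiblings hfin h.mem.1 h'.mem.1 hd
  have hlt := hZ B h.parent_mem.1 h.ssubset.1 h'.ssubset.1
  have hKX : K = X := by
    by_contra hn
    exact hlt.1.2 (h.le_of_ssubset X hXY.left_mem_struct (hX.ssubset_of_ne hn))
  have hKY : K' = Y := by
    by_contra hn
    exact hlt.2.2 (h'.le_of_ssubset Y hXY.symm.left_mem_struct (hY.ssubset_of_ne hn))
  rwa [hKX, hKY]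

theorem IsChild.exists_sibling {F : Set (Set Ω)} {K B : Set Ω} (h : IsChild (struct F) K B) :
    ∃ K', K ≠ K' ∧ IsChild (struct F) K' B := by
  rcases h.mem.2 with hr | ⟨K', hs⟩
  · exact absurd ⟨B, h.parent_mem.1, h.ssubset⟩ hr.2
  · refine ⟨K', hs.2.2.1, hs.symm.left_mem_struct, h.parent_mem,
      (hs.ssubset_iff h.parent_mem.1).1 h.ssubset, fun E hE hlt => ?_⟩
    exact h.le_of_ssubset E hE ((hs.ssubset_iff hE.1).2 hlt)

/-- Two disjoint members below a structure node lie in children of that node. -/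
theorem IsLaminar.exists_child_of_disjoint {F : Set (Set Ω)} (hF : IsLaminar F) (hfin : F.Finite)
    {X Y B : Set Ω} (hX : X ∈ F) (hY : Y ∈ F) (hB : B ∈ struct F) (hXY : Disjoint X Y)
    (hXB : X ⊆ B) (hYB : Y ⊆ B) : ∃ K, IsChild (struct F) K B ∧ X ⊆ K := by
  obtain ⟨X', Y', hs, hXX', -, hZ⟩ := hF.exists_directSiblings hfin hX hY hXY
  obtain ⟨K, hK, hXK⟩ := (hF.mono (struct_subset F)).exists_child_superset
    (hfin.subset (struct_subset F)) hs.left_mem_struct hB (hZ B hB.1 hXB hYB).1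
  exact ⟨K, hK, hXX'.trans hXK⟩

/-- A member meeting the structure node `B` lies in a child of `B` or contains all of them. -/
theorem IsLaminar.subset_child_or_forall {F : Set (Set Ω)} (hF : IsLaminar F) (hfin : F.Finite)
    {E B : Set Ω} (hE : E ∈ F) (hB : B ∈ struct F) (hEB : ¬ Disjoint E B) :
    (∃ K, IsChild (struct F) K B ∧ E ⊆ K) ∨ ∀ K, IsChild (struct F) K B → K ⊆ E := by
  rw [or_iff_not_imp_right]
  intro hn
  push Not at hn
  obtain ⟨K, hK, hKE⟩ := hn
  have hEB' : E ⊆ B := by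
    rcases hF.cases E hE B hB.1 with h | h | h
    · exact absurd h hEB
    · exact h
    · exact absurd (hK.ssubset.1.trans h) hKE
  rcases hF.cases E hE K hK.mem.1 with h | h | h
  · exact hF.exists_child_of_disjoint hfin hE hK.mem.1 hB h hEB' hK.ssubset.1
  · exact ⟨K, hK, h⟩
  · exact absurd h hKE

/-! ### Transport along isomorphisms -/

theorem IsForestIso.ssubset_iff {F F' : Set (Set Ω)} {ζ : Set Ω → Set Ω} (h : IsForestIso F F' ζ)
    {A B : Set Ω} (hA : A ∈ F) (hB : B ∈ F) : A ⊂ B ↔ ζ A ⊂ ζ B := by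
  simp only [ssubset_iff_subset_not_subset, h.subset_iff A hA B hB, h.subset_iff B hB A hA]

theorem IsForestIso.isChild_iff {F F' : Set (Set Ω)} {ζ : Set Ω → Set Ω} (h : IsForestIso F F' ζ)
    {A B : Set Ω} (hA : A ∈ F) (hB : B ∈ F) : IsChild F A B ↔ IsChild F' (ζ A) (ζ B) := by
  constructor
  · intro hc
    refine ⟨h.bijOn.mapsTo hA, h.bijOn.mapsTo hB, (h.ssubset_iff hA hB).1 hc.ssubset, ?_⟩
    intro E hE hlt
    obtain ⟨D, hD, rfl⟩ := h.bijOn.surjOn hE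
    exact (h.subset_iff B hB D hD).1 (hc.le_of_ssubset D hD ((h.ssubset_iff hA hD).2 hlt))
  · intro hc
    refine ⟨hA, hB, (h.ssubset_iff hA hB).2 hc.ssubset, fun D hD hlt => ?_⟩
    exact (h.subset_iff B hB D hD).2
      (hc.le_of_ssubset _ (h.bijOn.mapsTo hD) ((h.ssubset_iff hA hD).1 hlt))

theorem IsForestIso.exists_isChild {F F' : Set (Set Ω)} {ζ : Set Ω → Set Ω}
    (h : IsForestIso F F' ζ) {B K : Set Ω} (hB : B ∈ F) (hK : IsChild F' K (ζ B)) :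
    ∃ A, IsChild F A B ∧ ζ A = K := by
  obtain ⟨A, hA, rfl⟩ := h.bijOn.surjOn hK.mem
  exact ⟨A, (h.isChild_iff hA hB).2 hK, rfl⟩

theorem IsForestIso.isRoot_iff {F F' : Set (Set Ω)} {ζ : Set Ω → Set Ω} (h : IsForestIso F F' ζ)
    {A : Set Ω} (hA : A ∈ F) : IsRoot F A ↔ IsRoot F' (ζ A) := by
  constructor
  · rintro ⟨-, hr⟩
    refine ⟨h.bijOn.mapsTo hA, ?_⟩
    rintro ⟨E, hE, hlt⟩
    obtain ⟨D, hD, rfl⟩ := h.bijOn.surjOn hE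
    exact hr ⟨D, hD, (h.ssubset_iff hA hD).2 hlt⟩
  · rintro ⟨-, hr⟩
    exact ⟨hA, fun ⟨D, hD, hlt⟩ => hr ⟨ζ D, h.bijOn.mapsTo hD, (h.ssubset_iff hA hD).1 hlt⟩⟩

theorem IsForestIso.struct_eq {F F' : Set (Set Ω)} {ζ : Set Ω → Set Ω} (h : IsForestIso F F' ζ)
    (hF : struct F = F) : struct F' = F' := by
  refine (struct_subset _).antisymm fun X hX => ⟨hX, ?_⟩
  obtain ⟨A, hA, rfl⟩ := h.bijOn.surjOn hX
  have hA' := hA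
  rw [← hF] at hA'
  rcases hA'.2 with hr | ⟨B, hs⟩
  · exact Or.inl ((h.isRoot_iff hA).1 hr)
  · refine Or.inr ⟨ζ B, hX, h.bijOn.mapsTo hs.2.1,
      fun he => hs.2.2.1 (h.bijOn.injOn hA hs.2.1 he), ?_⟩
    ext E
    constructor
    · rintro ⟨hE, hlt⟩
      obtain ⟨D, hD, rfl⟩ := h.bijOn.surjOn hE
      exact ⟨hE, (h.ssubset_iff hs.2.1 hD).1
        ((hs.ssubset_iff hD).1 ((h.ssubset_iff hA hD).2 hlt))⟩
    · rintro ⟨hE, hlt⟩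
      obtain ⟨D, hD, rfl⟩ := h.bijOn.surjOn hE
      exact ⟨hE, (h.ssubset_iff hA hD).1
        ((hs.ssubset_iff hD).2 ((h.ssubset_iff hs.2.1 hD).2 hlt))⟩

theorem IsFRM.comp {F F' F'' : Set (Set Ω)} {ζ ξ : Set Ω → Set Ω} (hζ : IsFRM F F' ζ)
    (hξ : IsFRM F' F'' ξ) : IsFRM F F'' (ξ ∘ ζ) where
  bijOn := hξ.bijOn.comp hζ.bijOn
  subset_iff A hA B hB := (hζ.subset_iff A hA B hB).trans
    (hξ.subset_iff _ (hζ.bijOn.mapsTo hA) _ (hζ.bijOn.mapsTo hB))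
  subset_map A hA := (hζ.subset_map A hA).trans (hξ.subset_map _ (hζ.bijOn.mapsTo hA))

theorem IsFRM.refl (F : Set (Set Ω)) : IsFRM F F id where
  bijOn := bijOn_id F
  subset_iff _ _ _ _ := Iff.rfl
  subset_map _ _ := Subset.rfl

theorem forestLE_of_succ {G : ℕ → Set (Set Ω)} (h : ∀ n, ForestLE (G n) (G (n + 1))) (n : ℕ) :
    ForestLE (G 0) (G n) := by
  induction n with
  | zero => exact ⟨id, IsFRM.refl _⟩
  | succ n ih =>
    obtain ⟨ζ, hζ⟩ := ih
    obtain ⟨ξ, hξ⟩ := h n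
    exact ⟨_, hζ.comp hξ⟩

theorem ForestLE.isFRM_frm {F F' : Set (Set Ω)} (h : ForestLE F F') : IsFRM F F' (frm F F') := by
  rw [frm, dif_pos h]
  exact h.choose_spec

/-- The maps `frm` are chosen independently for each n; uniqueness of forest relating maps makes the
one to stage n + 1 factor through stage n. -/
theorem frm_subset_frm_succ {G : ℕ → Set (Set Ω)} (hG : ∀ n, IsLaminar (G n))
    (hfin : (G 0).Finite) (h : ∀ n, ForestLE (G n) (G (n + 1))) {A : Set Ω} (hA : A ∈ G 0)
    (n : ℕ) : frm (G 0) (G n) A ⊆ frm (G 0) (G (n + 1)) A := by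
  have h₁ := (forestLE_of_succ h n).isFRM_frm
  have h₂ := (forestLE_of_succ h (n + 1)).isFRM_frm
  obtain ⟨ξ, hξ⟩ := h n
  rw [IsFRM.unique hfin (hG 0).nonempty (hG (n + 1)).cases h₂ (h₁.comp hξ) hA]
  exact hξ.subset_map _ (h₁.bijOn.mapsTo hA)

end Laminar

/-! ### Base measures -/

section BaseMeasures

set_option linter.unusedSectionVars false

variable {Ω : Type*} [TopologicalSpace Ω] [MeasurableSpace Ω]
variable {𝒜 : Set (Set Ω)} {𝒬 : Set Ω → Measure Ω} {perp : Set Ω → Set Ω → Prop}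

theorem IsClusteringBase.measurableSet (hbase : IsClusteringBase 𝒜 𝒬 perp) {A : Set Ω}
    (hA : A ∈ 𝒜) : MeasurableSet A := hbase.separation.base_measurable A hA

/-- Restricting both sides to the intersection makes it separated from itself. -/
theorem IsSeparationRelation.disjoint (h : IsSeparationRelation 𝒜 perp) {A B : Set Ω}
    (hA : MeasurableSet A) (hB : MeasurableSet B) (hAB : perp A B) : Disjoint A B := by
  have hm := hA.inter hB
  have h₁ : perp (A ∩ B) B := h.monotonicity _ _ _ hm hA hB inter_subset_left hAB
  have h₂ : perp B (A ∩ B) := h.symm _ _ hm hB h₁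
  exact disjoint_iff_inter_eq_empty.2 <| h.reflexivity _ hm <|
    h.monotonicity _ _ _ hm hB hm inter_subset_right h₂

/-- A compact subset of the complement is covered by finitely many null neighbourhoods. Via
fittedness this concentrates each base measure on its base set. -/
theorem measure_compl_support_of_innerRegular [OpensMeasurableSpace Ω] (μ : Measure Ω)
    [hμ : μ.InnerRegular] : μ μ.supportᶜ = 0 := by
  have hop : IsOpen μ.supportᶜ := Measure.isClosed_support.isOpen_compl
  by_contra hne
  obtain ⟨K, hK, hKc, hpos⟩ := hμ.innerRegular hop.measurableSet 0 (pos_iff_ne_zero.2 hne)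
  refine hpos.ne' (hKc.measure_zero_of_nhdsWithin fun x hx => ?_)
  obtain ⟨U, hU, hU0⟩ := Measure.notMem_support_iff_exists.1 (hK hx)
  exact ⟨U, mem_nhdsWithin_of_mem_nhds hU, hU0⟩

theorem IsClusteringBase.measure_compl_self [OpensMeasurableSpace Ω]
    (hbase : IsClusteringBase 𝒜 𝒬 perp) {A : Set Ω} (hA : A ∈ 𝒜) : 𝒬 A Aᶜ = 0 := by
  have := (hbase.memM A hA).innerRegular
  have h := measure_compl_support_of_innerRegular (𝒬 A)
  rwa [← hbase.fittedness A hA] at h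

theorem IsClusteringBase.measure_inter_self [OpensMeasurableSpace Ω]
    (hbase : IsClusteringBase 𝒜 𝒬 perp) {A : Set Ω} (hA : A ∈ 𝒜) (D : Set Ω) :
    𝒬 A (D ∩ A) = 𝒬 A D :=
  measure_inter_conull (hbase.measure_compl_self hA)

theorem IsClusteringBase.measure_self [OpensMeasurableSpace Ω]
    (hbase : IsClusteringBase 𝒜 𝒬 perp) {A : Set Ω} (hA : A ∈ 𝒜) : 𝒬 A A = 1 := by
  have := hbase.prob A hA
  rw [← measure_univ (μ := 𝒬 A), ← hbase.measure_inter_self hA univ, univ_inter]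

/-- Flatness without its case distinction: if the smaller set is null for the larger base measure,
both sides vanish. -/
theorem IsClusteringBase.measure_eq_mul (hbase : IsClusteringBase 𝒜 𝒬 perp) {A B D : Set Ω}
    (hA : A ∈ 𝒜) (hB : B ∈ 𝒜) (hAB : A ⊆ B) (hD : MeasurableSet D) (hDA : D ⊆ A) :
    𝒬 B D = 𝒬 B A * 𝒬 A D := by
  have := hbase.prob B hB
  rcases eq_or_ne (𝒬 B A) 0 with h0 | h0
  · rw [h0, zero_mul]
    exact measure_mono_null hDA h0
  · rcases hbase.flatness A hA B hB hAB with h | h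
    · exact absurd h h0
    · rw [h D hD, inter_eq_left.2 hDA, ENNReal.mul_div_cancel h0 (measure_ne_top _ _)]

theorem IsBaseMeasureOn.measure_self [OpensMeasurableSpace Ω]
    (hbase : IsClusteringBase 𝒜 𝒬 perp) {a : Measure Ω} {A : Set Ω}
    (ha : IsBaseMeasureOn 𝒜 𝒬 a A) : 0 < a A := by
  obtain ⟨hA, r, hr, rfl⟩ := ha
  rw [Measure.smul_apply, hbase.measure_self hA, ENNReal.smul_def, smul_eq_mul, mul_one]
  exact_mod_cast hr

/-- Domination on one non-null subset of `A` is domination everywhere. -/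
theorem IsBaseMeasureOn.smul_le [OpensMeasurableSpace Ω] (hbase : IsClusteringBase 𝒜 𝒬 perp)
    {a b : Measure Ω} {A B D : Set Ω} (ha : IsBaseMeasureOn 𝒜 𝒬 a A)
    (hb : IsBaseMeasureOn 𝒜 𝒬 b B) (hAB : A ⊆ B) (hD : MeasurableSet D) (hDA : D ⊆ A)
    {t : ℝ≥0} (hle : t * a D ≤ b D) (hpos : 0 < a D) : t • a ≤ b := by
  obtain ⟨hA, r, hr, rfl⟩ := ha
  obtain ⟨hB, s, hs, rfl⟩ := hb
  have := hbase.prob A hA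
  simp only [Measure.smul_apply, ENNReal.smul_def, smul_eq_mul] at hle hpos
  have hD0 : 𝒬 A D ≠ 0 := fun h => by simp [h] at hpos
  -- Cancelling the positive finite factor `𝒬 A D` leaves an inequality between constants that no
  -- longer involves D.
  rw [hbase.measure_eq_mul hA hB hAB hD hDA, ← mul_assoc, ← mul_assoc,
    ENNReal.mul_le_mul_iff_left hD0 (measure_ne_top _ _)] at hle
  refine Measure.le_iff.2 fun X hX => ?_
  simp only [Measure.smul_apply, ENNReal.smul_def, smul_eq_mul]
  have hXA := hX.inter (hbase.measurableSet hA)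
  calc (t : ℝ≥0∞) * (r * 𝒬 A X) = t * r * 𝒬 A (X ∩ A) := by
        rw [hbase.measure_inter_self hA, mul_assoc]
    _ ≤ s * 𝒬 B A * 𝒬 A (X ∩ A) := by gcongr
    _ = s * 𝒬 B (X ∩ A) := by
        rw [hbase.measure_eq_mul hA hB hAB hXA inter_subset_right, mul_assoc]
    _ ≤ s * 𝒬 B X := by gcongr; exact inter_subset_left

/-- On A the measure b is a multiple of a, so it cannot charge an a-null subset of A. -/
theorem IsBaseMeasureOn.pos_of_pos (hbase : IsClusteringBase 𝒜 𝒬 perp)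
    {a b : Measure Ω} {A B D : Set Ω} (ha : IsBaseMeasureOn 𝒜 𝒬 a A)
    (hb : IsBaseMeasureOn 𝒜 𝒬 b B) (hAB : A ⊆ B) (hD : MeasurableSet D) (hDA : D ⊆ A)
    (hpos : 0 < b D) : 0 < a D := by
  obtain ⟨hA, r, hr, rfl⟩ := ha
  obtain ⟨hB, s, hs, rfl⟩ := hb
  simp only [Measure.smul_apply, ENNReal.smul_def, smul_eq_mul] at hpos ⊢
  rw [hbase.measure_eq_mul hA hB hAB hD hDA] at hpos
  have hD0 : 𝒬 A D ≠ 0 := fun h => by simp [h] at hpos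
  exact ENNReal.mul_pos (by exact_mod_cast hr.ne') hD0

theorem IsSubadditive.merge {P : Measure Ω} (hsub : IsSubadditive 𝒜 𝒬 P) {a a' : Measure Ω}
    {A A' : Set Ω} (ha : IsBaseMeasureOn 𝒜 𝒬 a A) (ha' : IsBaseMeasureOn 𝒜 𝒬 a' A')
    (hle : a ≤ P) (hle' : a' ≤ P) (hpos : 0 < P (A ∩ A')) :
    ∃ b B, IsBaseMeasureOn 𝒜 𝒬 b B ∧ b ≤ P ∧ A ⊆ B ∧ A' ⊆ B ∧ (a ≤ b ∨ a' ≤ b) := by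
  obtain ⟨b, ⟨B, hb, hB, hbP⟩, h⟩ := hsub a a' A A' ha ha' hle hle' hpos
  exact ⟨b, B, hb, hbP, subset_union_left.trans hB, subset_union_right.trans hB, h⟩

/-! ### Levels of simple measures -/

variable {Q : Measure Ω} {F : Finset (Set Ω)} {c : Set Ω → ℝ≥0}

theorem IsForest.isLaminar (hsep : IsSeparationRelation 𝒜 perp) {G : Set (Set Ω)}
    (hG : IsForest 𝒜 perp G) : IsLaminar G where
  nonempty A hA := hsep.base_nonempty A (hG.subset hA)
  cases A hA B hB := (hG.separated A hA B hB).imp_left <|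
    hsep.disjoint (hsep.base_measurable A (hG.subset hA)) (hsep.base_measurable B (hG.subset hB))

theorem IsSimpleRep.apply (h : IsSimpleRep 𝒜 𝒬 perp Q F c) (D : Set Ω) :
    Q D = ∑ A ∈ F, (c A : ℝ≥0∞) * 𝒬 A D := by
  rw [h.eq_sum, Measure.finsetSum_apply]
  rfl

theorem IsSimpleRep.smul_le (h : IsSimpleRep 𝒜 𝒬 perp Q F c) {A : Set Ω} (hA : A ∈ F) :
    c A • 𝒬 A ≤ Q := by
  refine Measure.le_iff.2 fun D _ => ?_
  rw [h.apply D]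
  exact Finset.single_le_sum (f := fun A => (c A : ℝ≥0∞) * 𝒬 A D) (fun _ _ => zero_le) hA

theorem IsSimpleRep.isBaseMeasureOn_smul (h : IsSimpleRep 𝒜 𝒬 perp Q F c) {A : Set Ω}
    (hA : A ∈ F) : IsBaseMeasureOn 𝒜 𝒬 (c A • 𝒬 A) A :=
  ⟨h.forest.subset hA, c A, h.pos A hA, rfl⟩

theorem IsSimpleRep.exists_mem_pos (h : IsSimpleRep 𝒜 𝒬 perp Q F c) {D : Set Ω} (hD : 0 < Q D) :
    ∃ A ∈ F, 0 < (c A • 𝒬 A) D := by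
  rw [h.apply D] at hD
  obtain ⟨A, hA, h0⟩ := Finset.exists_ne_zero_of_sum_ne_zero hD.ne'
  exact ⟨A, hA, pos_iff_ne_zero.2 h0⟩

theorem IsSimpleRep.isBaseMeasureOn_level [OpensMeasurableSpace Ω]
    (hbase : IsClusteringBase 𝒜 𝒬 perp) (h : IsSimpleRep 𝒜 𝒬 perp Q F c) {A : Set Ω}
    (hA : A ∈ F) : IsBaseMeasureOn 𝒜 𝒬 (level 𝒬 F c A) A := by
  classical
  have hA𝒜 : A ∈ 𝒜 := h.forest.subset hA
  set s : ℝ≥0∞ := ∑ A' ∈ F.filter (fun A' => A ⊆ A'), (c A' : ℝ≥0∞) * 𝒬 A' A with hs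
  have hfin : s ≠ ∞ := by
    refine ENNReal.sum_ne_top.2 fun A' hA' => ?_
    have := hbase.prob A' (h.forest.subset (Finset.mem_filter.1 hA').1)
    exact ENNReal.mul_ne_top ENNReal.coe_ne_top (measure_ne_top _ _)
  have hpos : 0 < s := by
    refine lt_of_lt_of_le ?_ (Finset.single_le_sum (f := fun A' => (c A' : ℝ≥0∞) * 𝒬 A' A)
      (fun _ _ => zero_le) (Finset.mem_filter.2 ⟨hA, Subset.rfl⟩))
    simp only [hbase.measure_self hA𝒜, mul_one]
    exact_mod_cast h.pos A hA
  refine ⟨hA𝒜, s.toNNReal, ENNReal.toNNReal_pos hpos.ne' hfin, ?_⟩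
  ext D _
  rw [level, Measure.smul_apply, Measure.smul_apply, ENNReal.smul_def, ENNReal.coe_toNNReal hfin,
    hs]

/-- By flatness every ancestor's contribution restricted to A is a multiple of `𝒬 A`; the level
gathers these multiples. -/
theorem IsSimpleRep.level_apply [OpensMeasurableSpace Ω] (hbase : IsClusteringBase 𝒜 𝒬 perp)
    (h : IsSimpleRep 𝒜 𝒬 perp Q F c) {A : Set Ω} (hA : A ∈ F) {D : Set Ω}
    (hD : MeasurableSet D) (hDA : D ⊆ A) :
    level 𝒬 F c A D = by classical exact ∑ A' ∈ F.filter (fun A' => A ⊆ A'), c A' * 𝒬 A' D := by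
  classical
  rw [level, Measure.smul_apply, smul_eq_mul, Finset.sum_mul]
  refine Finset.sum_congr (by congr!) fun A' hA' => ?_
  rw [Finset.mem_filter] at hA'
  rw [hbase.measure_eq_mul (h.forest.subset hA) (h.forest.subset hA'.1) hA'.2 hD hDA, mul_assoc]

theorem IsSimpleRep.level_le [OpensMeasurableSpace Ω] (hbase : IsClusteringBase 𝒜 𝒬 perp)
    (h : IsSimpleRep 𝒜 𝒬 perp Q F c) {A : Set Ω} (hA : A ∈ F) : level 𝒬 F c A ≤ Q := by
  classical
  refine Measure.le_iff.2 fun D hD => ?_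
  have hA𝒜 : A ∈ 𝒜 := h.forest.subset hA
  obtain ⟨-, r, -, hr⟩ := h.isBaseMeasureOn_level hbase hA
  have h₁ : level 𝒬 F c A D = level 𝒬 F c A (D ∩ A) := by
    rw [hr, Measure.smul_apply, Measure.smul_apply, hbase.measure_inter_self hA𝒜]
  rw [h₁, h.level_apply hbase hA (hD.inter (hbase.measurableSet hA𝒜)) inter_subset_right]
  refine le_trans ?_ (measure_mono (inter_subset_left (t := A)))
  rw [h.apply]
  exact Finset.sum_le_sum_of_subset (by intro; simp +contextual)

/-! ### Exclusive parts of nodes, where levels and the simple measure coincide -/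

/-- The part of `C` that lies in no smaller node of `F`. -/
def exclusivePart (F : Finset (Set Ω)) (C : Set Ω) : Set Ω := {x ∈ C | ∀ E ∈ F, E ⊂ C → x ∉ E}

theorem measurableSet_exclusivePart (hF : ∀ A ∈ F, MeasurableSet A) {C : Set Ω} (hC : C ∈ F) :
    MeasurableSet (exclusivePart F C) := by
  classical
  have : exclusivePart F C = C \ ⋃ E ∈ F.filter (fun E => E ⊂ C), E := by
    ext x
    simp [exclusivePart]
  rw [this]
  exact (hF C hC).diff (Finset.measurableSet_biUnion _ fun E hE => hF E (Finset.mem_filter.1 hE).1)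

theorem exists_mem_exclusivePart {B : Set Ω} (hB : B ∈ F)
    {x : Ω} (hx : x ∈ B) : ∃ C ∈ F, C ⊆ B ∧ x ∈ exclusivePart F C := by
  obtain ⟨C, hC⟩ := (F.finite_toSet.subset (sep_subset (F : Set (Set Ω))
    fun C => C ⊆ B ∧ x ∈ C)).exists_minimal ⟨B, hB, Subset.rfl, hx⟩
  refine ⟨C, hC.prop.1, hC.prop.2.1, hC.prop.2.2, fun E hE hEC hxE => ?_⟩
  exact hEC.2 (hC.2 ⟨hE, hEC.1.trans hC.prop.2.1, hxE⟩ hEC.1)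

theorem pairwiseDisjoint_exclusivePart (hF : IsLaminar (F : Set (Set Ω))) :
    (F : Set (Set Ω)).PairwiseDisjoint (exclusivePart F) := by
  intro C hC C' hC' hne
  refine disjoint_left.2 fun x hx hx' => ?_
  rcases hF.comparable hC hC' (singleton_nonempty x) (singleton_subset_iff.2 hx.1)
    (singleton_subset_iff.2 hx'.1) with h | h
  · exact hx'.2 C hC (h.ssubset_of_ne hne) hx.1
  · exact hx.2 C' hC' (h.ssubset_of_ne hne.symm) hx'.1

/-- A node not containing C is disjoint from C or strictly inside it, hence misses the exclusive
part. Only ancestors of C contribute to Q there. -/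
theorem IsSimpleRep.level_apply_of_subset_exclusivePart [OpensMeasurableSpace Ω]
    (hbase : IsClusteringBase 𝒜 𝒬 perp) (h : IsSimpleRep 𝒜 𝒬 perp Q F c) {C : Set Ω}
    (hC : C ∈ F) {D : Set Ω} (hD : MeasurableSet D) (hDC : D ⊆ exclusivePart F C) :
    level 𝒬 F c C D = Q D := by
  classical
  have hlam := h.forest.isLaminar hbase.separation
  rw [h.level_apply hbase hC hD fun x hx => (hDC hx).1, h.apply]
  refine (Finset.sum_subset_zero_on_sdiff (Finset.filter_subset _ _) ?_ fun _ _ => rfl)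
  intro E hE
  rw [Finset.mem_sdiff, Finset.mem_filter] at hE
  have hCE : ¬ C ⊆ E := fun h' => hE.2 ⟨hE.1, h'⟩
  have hdis : Disjoint D E := disjoint_left.2 fun x hx hxE => by
    rcases hlam.comparable hC hE.1 (singleton_nonempty x) (singleton_subset_iff.2 (hDC hx).1)
      (singleton_subset_iff.2 hxE) with h' | h'
    · exact hCE h'
    · exact (hDC hx).2 E hE.1 ⟨h', hCE⟩ hxE
  rw [measure_mono_null hdis.subset_compl_right
    (hbase.measure_compl_self (h.forest.subset hE.1)), mul_zero]

end BaseMeasures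

/-! ### Towers of structures and their limits -/

section Towers

set_option linter.unusedSectionVars false

variable {Ω : Type*} [TopologicalSpace Ω] [MeasurableSpace Ω]
variable {𝒜 : Set (Set Ω)} {𝒬 : Set Ω → Measure Ω} {perp : Set Ω → Set Ω → Prop} {P : Measure Ω}

/-- An adapted isomonotone sequence with explicit coefficients, whose structures are indexed
monotonically by `I` through the isomorphisms `T n`. -/
structure IsAdaptedTower (𝒜 : Set (Set Ω)) (𝒬 : Set Ω → Measure Ω) (perp : Set Ω → Set Ω → Prop)
    (P : Measure Ω) (Q : ℕ → Measure Ω) (F : ℕ → Finset (Set Ω)) (c : ℕ → Set Ω → ℝ≥0)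
    (I : Set (Set Ω)) (T : ℕ → Set Ω → Set Ω) : Prop where
  rep : ∀ n, IsSimpleRep 𝒜 𝒬 perp (Q n) (F n) (c n)
  adapted : ∀ n A₁ A₂, DirectSiblings (F n : Set (Set Ω)) A₁ A₂ →
      Grounded 𝒜 𝒬 P (F n) A₁ A₂ ∧ Fine 𝒜 𝒬 P (F n) A₁ A₂ ∧
      StrictlyMotivated 𝒜 𝒬 P A₁ A₂ (level 𝒬 (F n) (c n) A₁) (level 𝒬 (F n) (c n) A₂)
  le : ∀ n, Q n ≤ P
  tendsto : ∀ B, MeasurableSet B → Tendsto (fun n => Q n B) atTop (𝓝 (P B))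
  iso : ∀ n, IsForestIso I (struct (F n : Set (Set Ω))) (T n)
  mono : ∀ i ∈ I, Monotone fun n => T n i

/-- The limit of the nodes with index `i`. -/
def limitNode (T : ℕ → Set Ω → Set Ω) (i : Set Ω) : Set Ω := ⋃ n, T n i

variable {Q : ℕ → Measure Ω} {F : ℕ → Finset (Set Ω)} {c : ℕ → Set Ω → ℝ≥0}
  {I : Set (Set Ω)} {T : ℕ → Set Ω → Set Ω}

theorem subset_limitNode (T : ℕ → Set Ω → Set Ω) (n : ℕ) (i : Set Ω) : T n i ⊆ limitNode T i :=
  subset_iUnion (fun n => T n i) n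

namespace IsAdaptedTower

theorem mem_struct (h : IsAdaptedTower 𝒜 𝒬 perp P Q F c I T) {i : Set Ω} (hi : i ∈ I) (n : ℕ) :
    T n i ∈ struct (F n : Set (Set Ω)) := (h.iso n).bijOn.mapsTo hi

theorem mem (h : IsAdaptedTower 𝒜 𝒬 perp P Q F c I T) {i : Set Ω} (hi : i ∈ I) (n : ℕ) :
    T n i ∈ F n := (h.mem_struct hi n).1

theorem mem_base (h : IsAdaptedTower 𝒜 𝒬 perp P Q F c I T) {n : ℕ} {A : Set Ω} (hA : A ∈ F n) :
    A ∈ 𝒜 := (h.rep n).forest.subset hA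

theorem isLaminar (hbase : IsClusteringBase 𝒜 𝒬 perp)
    (h : IsAdaptedTower 𝒜 𝒬 perp P Q F c I T) (n : ℕ) : IsLaminar (F n : Set (Set Ω)) :=
  (h.rep n).forest.isLaminar hbase.separation

theorem measurableSet (hbase : IsClusteringBase 𝒜 𝒬 perp)
    (h : IsAdaptedTower 𝒜 𝒬 perp P Q F c I T) {i : Set Ω} (hi : i ∈ I) (n : ℕ) :
    MeasurableSet (T n i) := hbase.measurableSet (h.mem_base (h.mem hi n))

theorem measurableSet_limitNode (hbase : IsClusteringBase 𝒜 𝒬 perp)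
    (h : IsAdaptedTower 𝒜 𝒬 perp P Q F c I T) {i : Set Ω} (hi : i ∈ I) :
    MeasurableSet (limitNode T i) := MeasurableSet.iUnion fun n => h.measurableSet hbase hi n

theorem limitNode_subset_limitNode (h : IsAdaptedTower 𝒜 𝒬 perp P Q F c I T) {i j : Set Ω}
    (hi : i ∈ I) (hj : j ∈ I) (hij : i ⊆ j) : limitNode T i ⊆ limitNode T j :=
  iUnion_mono fun n => ((h.iso n).subset_iff i hi j hj).1 hij

theorem isChild (h : IsAdaptedTower 𝒜 𝒬 perp P Q F c I T) {i j : Set Ω} (hij : IsChild I i j)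
    (n : ℕ) : IsChild (struct (F n : Set (Set Ω))) (T n i) (T n j) :=
  ((h.iso n).isChild_iff hij.mem hij.parent_mem).1 hij

theorem disjoint_limitNode (hbase : IsClusteringBase 𝒜 𝒬 perp)
    (h : IsAdaptedTower 𝒜 𝒬 perp P Q F c I T) {i j : Set Ω} (hi : i ∈ I) (hj : j ∈ I)
    (hij : ¬ i ⊆ j) (hji : ¬ j ⊆ i) : Disjoint (limitNode T i) (limitNode T j) := by
  refine disjoint_iUnion_left.2 fun n => disjoint_iUnion_right.2 fun m => ?_
  have hd : Disjoint (T (max n m) i) (T (max n m) j) := by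
    rcases (h.isLaminar hbase (max n m)).cases _ (h.mem hi _) _ (h.mem hj _) with h' | h' | h'
    · exact h'
    · exact absurd (((h.iso _).subset_iff i hi j hj).2 h') hij
    · exact absurd (((h.iso _).subset_iff j hj i hi).2 h') hji
  exact hd.mono (h.mono i hi (le_max_left n m)) (h.mono j hj (le_max_right n m))

theorem disjoint_limitNode_of_isChild (hbase : IsClusteringBase 𝒜 𝒬 perp)
    (h : IsAdaptedTower 𝒜 𝒬 perp P Q F c I T) {i j k : Set Ω} (hi : IsChild I i k)
    (hj : IsChild I j k) (hij : i ≠ j) : Disjoint (limitNode T i) (limitNode T j) :=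
  h.disjoint_limitNode hbase hi.mem hj.mem
    (fun h' => hj.ssubset.2 (hi.le_of_ssubset j hj.mem (h'.ssubset_of_ne hij)))
    (fun h' => hi.ssubset.2 (hj.le_of_ssubset i hi.mem (h'.ssubset_of_ne hij.symm)))

theorem tendsto_measure_inter (h : IsAdaptedTower 𝒜 𝒬 perp P Q F c I T) {i : Set Ω} (hi : i ∈ I) (μ : Measure Ω)
    (X : Set Ω) :
    Tendsto (fun m => μ (X ∩ T m i)) atTop (𝓝 (μ (X ∩ limitNode T i))) := by
  rw [limitNode, inter_iUnion]
  exact tendsto_measure_iUnion_atTop fun m n hmn => inter_subset_inter_right _ (h.mono i hi hmn)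

theorem eventually_pos (h : IsAdaptedTower 𝒜 𝒬 perp P Q F c I T) {i : Set Ω} (hi : i ∈ I) {X : Set Ω}
    (hX : 0 < P (X ∩ limitNode T i)) : ∀ᶠ m in atTop, 0 < P (X ∩ T m i) :=
  (h.tendsto_measure_inter hi P X).eventually (lt_mem_nhds hX)

variable [OpensMeasurableSpace Ω]

theorem isBaseMeasureOn_level (hbase : IsClusteringBase 𝒜 𝒬 perp)
    (h : IsAdaptedTower 𝒜 𝒬 perp P Q F c I T) {n : ℕ} {A : Set Ω} (hA : A ∈ F n) :
    IsBaseMeasureOn 𝒜 𝒬 (level 𝒬 (F n) (c n) A) A := (h.rep n).isBaseMeasureOn_level hbase hA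

theorem level_le (hbase : IsClusteringBase 𝒜 𝒬 perp)
    (h : IsAdaptedTower 𝒜 𝒬 perp P Q F c I T) {n : ℕ} {A : Set Ω} (hA : A ∈ F n) :
    level 𝒬 (F n) (c n) A ≤ P := ((h.rep n).level_le hbase hA).trans (h.le n)

theorem measure_pos (hbase : IsClusteringBase 𝒜 𝒬 perp)
    (h : IsAdaptedTower 𝒜 𝒬 perp P Q F c I T) {n : ℕ} {A : Set Ω} (hA : A ∈ F n) : 0 < P A :=
  ((h.isBaseMeasureOn_level hbase hA).measure_self hbase).trans_le (h.level_le hbase hA A)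

/-- Inside a limit node, a base measure `a ≤ P` is eventually almost dominated, on some part of
any set it charges, by the level of a node. -/
theorem eventually_exists_level_ge [IsFiniteMeasure P] (hbase : IsClusteringBase 𝒜 𝒬 perp)
    (h : IsAdaptedTower 𝒜 𝒬 perp P Q F c I T) {a : Measure Ω} (haP : a ≤ P) {t : ℝ≥0}
    (ht : t < 1) {j : Set Ω} (hj : j ∈ I) {X : Set Ω} (hX : MeasurableSet X)
    (hXj : P (X \ limitNode T j) = 0) (hpos : 0 < a X) :
    ∀ᶠ m in atTop, ∃ C ∈ F m, C ⊆ T m j ∧ ∃ D, MeasurableSet D ∧ D ⊆ X ∩ C ∧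
      t * a D ≤ level 𝒬 (F m) (c m) C D ∧ 0 < a D := by
  classical
  by_contra hcon
  rw [not_eventually] at hcon
  obtain ⟨u, hu⟩ : ∃ u : ℝ≥0, u + t = 1 := ⟨1 - t, tsub_add_cancel_of_le ht.le⟩
  have hu0 : u ≠ 0 := by
    rintro rfl
    rw [zero_add] at hu
    exact ht.ne hu
  have huE : (u : ℝ≥0∞) + t = 1 := by exact_mod_cast hu
  -- Whenever the claim fails at stage m, `Q m` falls short of `P` by at least the fraction u = 1 -
  -- t of a on `X ∩ T m j`.
  have hbound : ∃ᶠ m in atTop, u * a (X ∩ T m j) + Q m univ ≤ P univ := by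
    refine hcon.mono fun m hm => ?_
    set D : Set Ω → Set Ω := fun C => X ∩ exclusivePart (F m) C with hD
    have hDm : ∀ C ∈ F m, MeasurableSet (D C) := fun C hC =>
      hX.inter (measurableSet_exclusivePart (fun A hA => hbase.measurableSet (h.mem_base hA)) hC)
    set J := (F m).filter (fun C => C ⊆ T m j) with hJ
    have hunion : X ∩ T m j = ⋃ C ∈ J, D C := by
      ext x
      simp only [mem_inter_iff, mem_iUnion, hJ, hD, Finset.mem_filter, exists_prop]
      constructor
      · rintro ⟨hxX, hxj⟩
        obtain ⟨C, hC, hCj, hxC⟩ := exists_mem_exclusivePart (h.mem hj m) hxj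
        exact ⟨C, ⟨hC, hCj⟩, hxX, hxC⟩
      · rintro ⟨C, ⟨-, hCj⟩, hxX, hxC⟩
        exact ⟨hxX, hCj hxC.1⟩
    have hdisj : (J : Set (Set Ω)).PairwiseDisjoint D := fun C hC C' hC' hne =>
      (pairwiseDisjoint_exclusivePart (h.isLaminar hbase m) (Finset.mem_filter.1 hC).1
        (Finset.mem_filter.1 hC').1 hne).mono inter_subset_right inter_subset_right
    have hsum : ∀ μ : Measure Ω, μ (X ∩ T m j) = ∑ C ∈ J, μ (D C) := fun μ => by
      rw [hunion, measure_biUnion_finset hdisj fun C hC => hDm C (Finset.mem_filter.1 hC).1]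
    -- On an exclusive part the level is `Q m`, so failure there means `Q m` < t a, whence u a + `Q
    -- m` ≤ a ≤ `P`.
    have hpiece : ∀ C ∈ J, u * a (D C) + Q m (D C) ≤ P (D C) := by
      intro C hC
      obtain ⟨hCF, hCj⟩ := Finset.mem_filter.1 hC
      have hlev := (h.rep m).level_apply_of_subset_exclusivePart hbase hCF (hDm C hCF)
        inter_subset_right
      rcases eq_or_ne (a (D C)) 0 with h0 | h0
      · rw [h0, mul_zero, zero_add]
        exact h.le m _
      · have hlt : Q m (D C) < t * a (D C) := by
          by_contra hge
          refine hm ⟨C, hCF, hCj, D C, hDm C hCF, ?_, ?_, pos_iff_ne_zero.2 h0⟩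
          · exact inter_subset_inter_right _ fun x hx => hx.1
          · rw [hlev]
            exact not_lt.1 hge
        calc u * a (D C) + Q m (D C) ≤ u * a (D C) + t * a (D C) := by gcongr
          _ = a (D C) := by rw [← add_mul, huE, one_mul]
          _ ≤ P (D C) := haP _
    have hXm : MeasurableSet (X ∩ T m j) := hX.inter (h.measurableSet hbase hj m)
    rw [← measure_add_measure_compl (μ := Q m) hXm, ← measure_add_measure_compl (μ := P) hXm,
      ← add_assoc]
    refine add_le_add ?_ (h.le m _)
    rw [hsum a, hsum (Q m), hsum P, Finset.mul_sum, ← Finset.sum_add_distrib]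
    exact Finset.sum_le_sum hpiece
  -- In the limit u a(X) + P(Ω) ≤ P(Ω), which finiteness of `P` rules out.
  have hlim : Tendsto (fun m => u * a (X ∩ T m j) + Q m univ) atTop
      (𝓝 (u * a (X ∩ limitNode T j) + P univ)) :=
    (ENNReal.Tendsto.const_mul (h.tendsto_measure_inter hj a X)
      (Or.inr ENNReal.coe_ne_top)).add (h.tendsto univ MeasurableSet.univ)
  have hle := le_of_tendsto_of_frequently hlim hbound
  have haX : a (X ∩ limitNode T j) = a X := by
    refine measure_inter_conull' (le_antisymm ?_ zero_le)
    exact (haP _).trans hXj.le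
  rw [haX] at hle
  have hzero : (u : ℝ≥0∞) * a X = 0 := by
    by_contra hne
    exact absurd hle (not_le.2 (by
      rw [add_comm]
      exact ENNReal.lt_add_right (measure_ne_top P univ) hne))
  rcases mul_eq_zero.1 hzero with h0 | h0
  · exact hu0 (by exact_mod_cast h0)
  · exact hpos.ne' h0

end IsAdaptedTower

/-! ### Strictly motivated pairs -/

/-- Base measures `a, a' ≤ P` on `K, K'` such that no base measure below `P` supports `K ∪ K'`
and dominates `t • a` or `t • a'`. -/
structure IsMotivatedPair (𝒜 : Set (Set Ω)) (𝒬 : Set Ω → Measure Ω) (P : Measure Ω) (t : ℝ≥0)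
    (a : Measure Ω) (K : Set Ω) (a' : Measure Ω) (K' : Set Ω) : Prop where
  left : IsBaseMeasureOn 𝒜 𝒬 a K
  right : IsBaseMeasureOn 𝒜 𝒬 a' K'
  left_le : a ≤ P
  right_le : a' ≤ P
  lt_one : t < 1
  not_le : ∀ b B, IsBaseMeasureOn 𝒜 𝒬 b B → b ≤ P → K ⊆ B → K' ⊆ B →
    ¬ t • a ≤ b ∧ ¬ t • a' ≤ b

theorem smul_measure_le {t : ℝ≥0} (ht : t ≤ 1) (a : Measure Ω) : t • a ≤ a := by
  refine Measure.le_iff.2 fun D _ => ?_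
  rw [Measure.smul_apply, ENNReal.smul_def, smul_eq_mul]
  exact mul_le_of_le_one_left' (by exact_mod_cast ht)

variable {t : ℝ≥0} {a a' : Measure Ω} {K K' : Set Ω}

theorem IsMotivatedPair.symm (h : IsMotivatedPair 𝒜 𝒬 P t a K a' K') :
    IsMotivatedPair 𝒜 𝒬 P t a' K' a K :=
  ⟨h.right, h.left, h.right_le, h.left_le, h.lt_one,
    fun b B hb hP hK hK' => (h.not_le b B hb hP hK' hK).symm⟩

variable [OpensMeasurableSpace Ω]

/-- Otherwise merge b with a, then the result with a'. The first merger dominates t a, either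
directly or by spreading the domination from D; the second then supports both sets and dominates t a
or t a', against motivation. The slack t is what allows approximate domination of a by b. -/
theorem IsMotivatedPair.measure_inter_eq_zero (hbase : IsClusteringBase 𝒜 𝒬 perp)
    (hsub : IsSubadditive 𝒜 𝒬 P) (h : IsMotivatedPair 𝒜 𝒬 P t a K a' K') {b : Measure Ω}
    {B D : Set Ω} (hb : IsBaseMeasureOn 𝒜 𝒬 b B) (hbP : b ≤ P) (hD : MeasurableSet D)
    (hDB : D ⊆ B) (hDK : D ⊆ K) (hle : t * a D ≤ b D) (hpos : 0 < a D) : P (B ∩ K') = 0 := by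
  by_contra hne
  have hBK : 0 < P (B ∩ K) :=
    hpos.trans_le ((h.left_le D).trans (measure_mono (subset_inter hDB hDK)))
  obtain ⟨b₁, B₁, hb₁, hb₁P, hBB₁, hKB₁, hor⟩ := hsub.merge hb h.left hbP h.left_le hBK
  have hab₁ : t • a ≤ b₁ := by
    rcases hor with h' | h'
    · exact h.left.smul_le hbase hb₁ hKB₁ hD hDK (hle.trans (h' D)) hpos
    · exact (smul_measure_le h.lt_one.le a).trans h'
  have hB₁K' : 0 < P (B₁ ∩ K') :=
    (pos_iff_ne_zero.2 hne).trans_le (measure_mono (inter_subset_inter_left _ hBB₁))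
  obtain ⟨b₂, B₂, hb₂, hb₂P, hB₁B₂, hK'B₂, hor⟩ := hsub.merge hb₁ h.right hb₁P h.right_le hB₁K'
  have hn := h.not_le b₂ B₂ hb₂ hb₂P (hKB₁.trans hB₁B₂) hK'B₂
  rcases hor with h' | h'
  · exact hn.1 (hab₁.trans h')
  · exact hn.2 ((smul_measure_le h.lt_one.le a').trans h')

theorem IsBaseMeasureOn.measure_inter_of_le (hbase : IsClusteringBase 𝒜 𝒬 perp) {b : Measure Ω}
    {B : Set Ω} (hb : IsBaseMeasureOn 𝒜 𝒬 b B) (hle : a ≤ b) (X : Set Ω) : a (X ∩ B) = a X := by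
  refine measure_inter_conull (le_antisymm ((hle _).trans ?_) zero_le)
  obtain ⟨hB, r, -, rfl⟩ := hb
  rw [Measure.smul_apply, hbase.measure_compl_self hB, smul_zero]

theorem IsMotivatedPair.measure_inter_eq_zero_of_le (hbase : IsClusteringBase 𝒜 𝒬 perp)
    (hsub : IsSubadditive 𝒜 𝒬 P) (h : IsMotivatedPair 𝒜 𝒬 P t a K a' K') {b : Measure Ω}
    {B : Set Ω} (hb : IsBaseMeasureOn 𝒜 𝒬 b B) (hbP : b ≤ P) (hle : a ≤ b) :
    P (B ∩ K') = 0 := by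
  refine h.measure_inter_eq_zero hbase hsub hb hbP
    ((hbase.measurableSet h.left.1).inter (hbase.measurableSet hb.1)) inter_subset_right
    inter_subset_left (le_trans ?_ (hle _)) ?_
  · exact mul_le_of_le_one_left' (by exact_mod_cast h.lt_one.le)
  · rw [hb.measure_inter_of_le hbase hle]
    exact h.left.measure_self hbase

theorem IsAdaptedTower.exists_isMotivatedPair (hbase : IsClusteringBase 𝒜 𝒬 perp)
    (h : IsAdaptedTower 𝒜 𝒬 perp P Q F c I T) {n : ℕ} {A B : Set Ω}
    (hs : DirectSiblings (F n : Set (Set Ω)) A B) :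
    ∃ t, IsMotivatedPair 𝒜 𝒬 P t (level 𝒬 (F n) (c n) A) A (level 𝒬 (F n) (c n) B) B := by
  obtain ⟨t, -, ht, hm⟩ := (h.adapted n A B hs).2.2
  refine ⟨t, h.isBaseMeasureOn_level hbase hs.1, h.isBaseMeasureOn_level hbase hs.2.1,
    h.level_le hbase hs.1, h.level_le hbase hs.2.1, ht, fun b E hb hbP hA hB => ?_⟩
  rw [← not_or]
  exact fun hor => hm b E hb hor ⟨E, hb, union_subset hA hB, hbP⟩

/-! ### A motivated pair inside a limit node -/

/-- At a late stage, nodes C and C' almost dominate a and a' on charged pieces. By motivation C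
almost misses K' and C' almost misses K, so neither contains the other. They are disjoint nodes
below k, hence each lies in a child of k. -/
theorem IsMotivatedPair.eventually_exists_child [IsFiniteMeasure P]
    (hbase : IsClusteringBase 𝒜 𝒬 perp) (hsub : IsSubadditive 𝒜 𝒬 P)
    (hp : IsMotivatedPair 𝒜 𝒬 P t a K a' K') (h : IsAdaptedTower 𝒜 𝒬 perp P Q F c I T)
    {k : Set Ω} (hk : k ∈ I) (hK : P (K \ limitNode T k) = 0) (hK' : P (K' \ limitNode T k) = 0)
    {X : Set Ω} (hX : MeasurableSet X) (hXK : X ⊆ K) (hpos : 0 < a X) :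
    ∀ᶠ m in atTop, ∃ j, IsChild I j k ∧
      ∃ D, MeasurableSet D ∧ D ⊆ X ∩ T m j ∧ 0 < a D := by
  have hev := h.eventually_exists_level_ge hbase hp.left_le hp.lt_one hk hX
    (measure_mono_null (sdiff_subset_sdiff_left hXK) hK) hpos
  have hev' := h.eventually_exists_level_ge hbase hp.right_le hp.lt_one hk
    (hbase.measurableSet hp.right.1) hK' (hp.right.measure_self hbase)
  filter_upwards [hev, hev'] with m ⟨C, hC, hCk, D, hD, hDC, hle, hDpos⟩
    ⟨C', hC', hCk', D', hD', hDC', hle', hDpos'⟩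
  have hzero := hp.measure_inter_eq_zero hbase hsub (h.isBaseMeasureOn_level hbase hC)
    (h.level_le hbase hC) hD (hDC.trans inter_subset_right)
    (hDC.trans (inter_subset_left.trans hXK)) hle hDpos
  have hzero' := hp.symm.measure_inter_eq_zero hbase hsub (h.isBaseMeasureOn_level hbase hC')
    (h.level_le hbase hC') hD' (hDC'.trans inter_subset_right)
    (hDC'.trans inter_subset_left) hle' hDpos'
  have hlam := h.isLaminar hbase m
  have hdis : Disjoint C C' := by
    rcases hlam.cases C hC C' hC' with h' | h' | h'
    · exact h'
    · have : D ⊆ C' ∩ K := fun x hx => ⟨h' (hDC hx).2, hXK (hDC hx).1⟩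
      exact absurd (le_antisymm ((hp.left_le D).trans
        ((measure_mono this).trans hzero'.le)) zero_le) hDpos.ne'
    · have : D' ⊆ C ∩ K' := fun x hx => ⟨h' (hDC' hx).2, (hDC' hx).1⟩
      exact absurd (le_antisymm ((hp.right_le D').trans
        ((measure_mono this).trans hzero.le)) zero_le) hDpos'.ne'
  obtain ⟨L, hL, hCL⟩ := hlam.exists_child_of_disjoint (F m).finite_toSet hC hC'
    (h.mem_struct hk m) hdis hCk hCk'
  obtain ⟨j, hj, rfl⟩ := (h.iso m).exists_isChild hk hL
  exact ⟨j, hj, D, hD, hDC.trans (inter_subset_inter_right _ hCL), hDpos⟩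

theorem IsMotivatedPair.exists_child_pos [IsFiniteMeasure P]
    (hbase : IsClusteringBase 𝒜 𝒬 perp) (hsub : IsSubadditive 𝒜 𝒬 P)
    (hp : IsMotivatedPair 𝒜 𝒬 P t a K a' K') (h : IsAdaptedTower 𝒜 𝒬 perp P Q F c I T)
    {k : Set Ω} (hk : k ∈ I) (hK : P (K \ limitNode T k) = 0)
    (hK' : P (K' \ limitNode T k) = 0) :
    ∃ j, IsChild I j k ∧ 0 < P (K ∩ limitNode T j) := by
  obtain ⟨m, j, hj, D, -, hDK, hpos⟩ := (hp.eventually_exists_child hbase hsub h hk hK hK'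
    (hbase.measurableSet hp.left.1) Subset.rfl (hp.left.measure_self hbase)).exists
  refine ⟨j, hj, hpos.trans_le ((hp.left_le D).trans (measure_mono ?_))⟩
  exact hDK.trans (inter_subset_inter_right _ (subset_limitNode T m j))

/-- A charged remainder would itself have a charged piece inside a child. This controls only a; `P`
may still charge the remainder. -/
theorem IsMotivatedPair.measure_diff_children [IsFiniteMeasure P]
    (hbase : IsClusteringBase 𝒜 𝒬 perp) (hsub : IsSubadditive 𝒜 𝒬 P)
    (hp : IsMotivatedPair 𝒜 𝒬 P t a K a' K') (h : IsAdaptedTower 𝒜 𝒬 perp P Q F c I T)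
    (hI : I.Finite) {k : Set Ω} (hk : k ∈ I) (hK : P (K \ limitNode T k) = 0)
    (hK' : P (K' \ limitNode T k) = 0) :
    a (K \ ⋃ j ∈ {j | IsChild I j k}, limitNode T j) = 0 := by
  by_contra hne
  have hfin : {j | IsChild I j k}.Finite := hI.subset fun j hj => hj.mem
  have hmeas : MeasurableSet (K \ ⋃ j ∈ {j | IsChild I j k}, limitNode T j) :=
    (hbase.measurableSet hp.left.1).diff
      (hfin.measurableSet_biUnion fun j hj => h.measurableSet_limitNode hbase hj.mem)
  obtain ⟨m, j, hj, D, -, hDK, hpos⟩ := (hp.eventually_exists_child hbase hsub h hk hK hK'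
    hmeas sdiff_subset (pos_iff_ne_zero.2 hne)).exists
  have : D = ∅ := eq_empty_of_forall_notMem fun x hx =>
    (hDK hx).1.2 (mem_biUnion (show j ∈ {j | IsChild I j k} from hj)
      (subset_limitNode T m j (hDK hx).2))
  simp [this] at hpos

/-- If K met two children, it could be merged with both, and fineness would extend the merger over
all children, including one that meets K'. -/
theorem IsMotivatedPair.child_unique [IsFiniteMeasure P]
    (hbase : IsClusteringBase 𝒜 𝒬 perp) (hsub : IsSubadditive 𝒜 𝒬 P)
    (hp : IsMotivatedPair 𝒜 𝒬 P t a K a' K') (h : IsAdaptedTower 𝒜 𝒬 perp P Q F c I T)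
    {k : Set Ω} (hk : k ∈ I) (hK : P (K \ limitNode T k) = 0)
    (hK' : P (K' \ limitNode T k) = 0) {j₁ j₂ : Set Ω} (hj₁ : IsChild I j₁ k)
    (hj₂ : IsChild I j₂ k) (hpos₁ : 0 < P (K ∩ limitNode T j₁))
    (hpos₂ : 0 < P (K ∩ limitNode T j₂)) : j₁ = j₂ := by
  by_contra hne
  obtain ⟨j', hj', hpos'⟩ := hp.symm.exists_child_pos hbase hsub h hk hK' hK
  obtain ⟨m, hm₁, hm₂, hm'⟩ := ((h.eventually_pos hj₁.mem hpos₁).and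
    ((h.eventually_pos hj₂.mem hpos₂).and (h.eventually_pos hj'.mem hpos'))).exists
  have hlam := h.isLaminar hbase m
  have hsib : ∀ i j, IsChild I i k → IsChild I j k → i ≠ j →
      DirectSiblings (F m : Set (Set Ω)) (T m i) (T m j) := fun i j hi hj hij =>
    (h.isChild hi m).directSiblings hlam (F m).finite_toSet (h.isChild hj m)
      fun he => hij ((h.iso m).bijOn.injOn hi.mem hj.mem he)
  have hs := hsib j₁ j₂ hj₁ hj₂ hne
  obtain ⟨s, hq⟩ := h.exists_isMotivatedPair hbase hs
  obtain ⟨b, B, hb, hbP, hKB, hB₁, hor⟩ := hsub.merge hp.left hq.left hp.left_le hq.left_le hm₁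
  obtain ⟨b₁, E, hb₁, hb₁P, hBE, hE₂, hor₁⟩ := hsub.merge hb hq.right hbP hq.right_le
    (hm₂.trans_le (measure_mono (inter_subset_inter_left _ hKB)))
  -- The two children are themselves strictly motivated, so a merger supporting both can dominate
  -- neither of their levels; only a remains.
  have hle : a ≤ b₁ := by
    have hn := hq.not_le b₁ E hb₁ hb₁P (hB₁.trans hBE) hE₂
    rcases hor₁ with h₁ | h₁
    · rcases hor with h₂ | h₂
      · exact h₂.trans h₁
      · exact absurd ((smul_measure_le hq.lt_one.le _).trans (h₂.trans h₁)) hn.1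
    · exact absurd ((smul_measure_le hq.lt_one.le _).trans h₁) hn.2
  obtain ⟨b₂, ⟨E₂, hb₂, hE₂', hb₂P⟩, hb₁₂⟩ := (h.adapted m _ _ hs).2.1 b₁
    ⟨E, hb₁, union_subset (hB₁.trans hBE) hE₂, hb₁P⟩
  have hmem : T m j' ∈ {A | A ∈ (F m : Set (Set Ω)) ∧
      strictAncestors (F m : Set (Set Ω)) A = strictAncestors (F m : Set (Set Ω)) (T m j₁)} := by
    refine ⟨h.mem hj'.mem m, ?_⟩
    by_cases he : j' = j₁
    · rw [he]
    · exact (hsib j' j₁ hj' hj₁ he).2.2.2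
  have hzero := hp.measure_inter_eq_zero_of_le hbase hsub hb₂ hb₂P (hle.trans hb₁₂)
  refine hm'.ne' (measure_mono_null ?_ hzero)
  exact fun x hx => ⟨hE₂' (subset_sUnion_of_mem hmem hx.2), hx.1⟩

/-- Let X be the part of K outside the only child that K meets. It is a-null by the preceding
results. If `P` charged X, some summand of `Q m` would too, and merging that summand with a gives a
contradiction. -/
theorem IsMotivatedPair.exists_child_measure_diff [IsFiniteMeasure P]
    (hbase : IsClusteringBase 𝒜 𝒬 perp) (hsub : IsSubadditive 𝒜 𝒬 P)
    (hp : IsMotivatedPair 𝒜 𝒬 P t a K a' K') (h : IsAdaptedTower 𝒜 𝒬 perp P Q F c I T)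
    (hI : I.Finite) {k : Set Ω} (hk : k ∈ I) (hK : P (K \ limitNode T k) = 0)
    (hK' : P (K' \ limitNode T k) = 0) :
    ∃ j, IsChild I j k ∧ P (K \ limitNode T j) = 0 := by
  obtain ⟨j, hj, hjpos⟩ := hp.exists_child_pos hbase hsub h hk hK hK'
  obtain ⟨j', hj', hpos'⟩ := hp.symm.exists_child_pos hbase hsub h hk hK' hK
  refine ⟨j, hj, ?_⟩
  have hfin : {j | IsChild I j k}.Finite := hI.subset fun j hj => hj.mem
  set X := K \ limitNode T j with hX
  have hKm := hbase.measurableSet hp.left.1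
  have hXm : MeasurableSet X := hKm.diff (h.measurableSet_limitNode hbase hj.mem)
  have hother : ∀ i, IsChild I i k → P (X ∩ limitNode T i) = 0 := by
    intro i hi
    by_cases hij : i = j
    · rw [hij, hX, sdiff_inter_self, measure_empty]
    · by_contra hne
      exact hij (hp.child_unique hbase hsub h hk hK hK' hi hj
        ((pos_iff_ne_zero.2 hne).trans_le
          (measure_mono (inter_subset_inter_left _ sdiff_subset))) hjpos)
  have haX : a X = 0 := by
    refine measure_mono_null (t := (K \ ⋃ i ∈ {i | IsChild I i k}, limitNode T i) ∪
      ⋃ i ∈ {i | IsChild I i k}, X ∩ limitNode T i) ?_ (measure_union_null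
      (hp.measure_diff_children hbase hsub h hI hk hK hK')
      ((measure_biUnion_null_iff hfin.countable).2 fun i hi =>
        le_antisymm ((hp.left_le _).trans (hother i hi).le) zero_le))
    intro x hx
    by_cases hxu : x ∈ ⋃ i ∈ {i | IsChild I i k}, limitNode T i
    · obtain ⟨i, hi, hxi⟩ := mem_iUnion₂.1 hxu
      exact Or.inr (mem_biUnion hi ⟨hx, hxi⟩)
    · exact Or.inl ⟨hx.1, hxu⟩
  by_contra hne
  have hXk : 0 < P (X ∩ limitNode T k) := by
    rw [measure_inter_conull' (measure_mono_null (sdiff_subset_sdiff_left sdiff_subset) hK)]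
    exact pos_iff_ne_zero.2 hne
  -- Setwise convergence needs a fixed set, so the stage of k is frozen at m₀ before m is sent to
  -- infinity.
  obtain ⟨m₀, hm₀⟩ := (h.eventually_pos hk hXk).exists
  obtain ⟨m, hQm, hm', hmm⟩ := (((h.tendsto _ (hXm.inter (h.measurableSet hbase hk m₀))).eventually
    (lt_mem_nhds hm₀)).and ((h.eventually_pos hj'.mem hpos').and
      (eventually_ge_atTop m₀))).exists
  obtain ⟨C, hC, hCpos⟩ := (h.rep m).exists_mem_pos hQm
  have hl := (h.rep m).isBaseMeasureOn_smul hC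
  have hlP := ((h.rep m).smul_le hC).trans (h.le m)
  set l := c m C • 𝒬 C with hldef
  have hlX : 0 < l X := hCpos.trans_le (measure_mono inter_subset_left)
  have hlXC : 0 < l (X ∩ C) := by rwa [hl.measure_inter_of_le hbase le_rfl]
  have hnd : ¬ Disjoint C (T m k) := by
    intro hd
    have : (X ∩ T m₀ k) ∩ C = ∅ := eq_empty_of_forall_notMem fun x hx =>
      disjoint_left.1 hd hx.2 (h.mono k hk hmm hx.1.2)
    rw [← hl.measure_inter_of_le hbase le_rfl, this, measure_empty] at hCpos
    exact lt_irrefl _ hCpos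
  -- A node inside a child cannot charge X, by `hother`; so C contains all the children of k at
  -- stage m.
  rcases (h.isLaminar hbase m).subset_child_or_forall (F m).finite_toSet hC (h.mem_struct hk m) hnd
    with ⟨L, hL, hCL⟩ | hall
  · obtain ⟨i, hi, rfl⟩ := (h.iso m).exists_isChild hk hL
    refine (hlXC.trans_le (hlP _)).ne' (measure_mono_null ?_ (hother i hi))
    exact inter_subset_inter_right _ (hCL.trans (subset_limitNode T m i))
  · have hCK : 0 < P (C ∩ K) := (hlXC.trans_le (hlP _)).trans_le
      (measure_mono fun x hx => ⟨hx.2, hx.1.1⟩)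
    obtain ⟨b, B, hb, hbP, hCB, hKB, hor⟩ := hsub.merge hl hp.left hlP hp.left_le hCK
    -- If b dominates l, it charges the a-null set X ⊆ K, where it is a multiple of a. If b
    -- dominates a, motivation makes B ∩ K' null, yet B contains a child meeting K'.
    rcases hor with hlb | hab
    · exact (hp.left.pos_of_pos hbase hb hKB hXm sdiff_subset (hlX.trans_le (hlb X))).ne' haX
    · have hzero := hp.measure_inter_eq_zero_of_le hbase hsub hb hbP hab
      refine hm'.ne' (measure_mono_null ?_ hzero)
      exact fun x hx => ⟨hCB (hall _ (h.isChild hj' m) hx.2), hx.1⟩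

end Towers

/-! ### Comparison of two towers -/

section Comparison

set_option linter.unusedSectionVars false

variable {Ω : Type*} [TopologicalSpace Ω] [MeasurableSpace Ω] [OpensMeasurableSpace Ω]
variable {𝒜 : Set (Set Ω)} {𝒬 : Set Ω → Measure Ω} {perp : Set Ω → Set Ω → Prop} {P : Measure Ω}
variable {Q Q' : ℕ → Measure Ω} {F F' : ℕ → Finset (Set Ω)} {c c' : ℕ → Set Ω → ℝ≥0}
  {I I' : Set (Set Ω)} {T T' : ℕ → Set Ω → Set Ω}

theorem measure_diff_null_trans {A B C : Set Ω} (h : P (A \ B) = 0) (h' : P (B \ C) = 0) :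
    P (A \ C) = 0 :=
  measure_mono_null (sdiff_triangle A B C) (measure_union_null h h')

namespace IsAdaptedTower

theorem measure_limitNode_pos (hbase : IsClusteringBase 𝒜 𝒬 perp)
    (h : IsAdaptedTower 𝒜 𝒬 perp P Q F c I T) {i : Set Ω} (hi : i ∈ I) :
    0 < P (limitNode T i) :=
  (h.measure_pos hbase (h.mem hi 0)).trans_le (measure_mono (subset_limitNode T 0 i))

theorem exists_sibling (h : IsAdaptedTower 𝒜 𝒬 perp P Q F c I T) {i k : Set Ω}
    (hi : IsChild I i k) : ∃ i', i ≠ i' ∧ IsChild I i' k := by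
  obtain ⟨K, hne, hK⟩ := (h.isChild hi 0).exists_sibling
  obtain ⟨i', hi', rfl⟩ := (h.iso 0).exists_isChild hi.parent_mem hK
  exact ⟨i', fun he => hne (by rw [he]), hi'⟩

/-- On limit nodes, inclusion up to a `P`-null set is inclusion. -/
theorem subset_of_measure_diff (hbase : IsClusteringBase 𝒜 𝒬 perp)
    (h : IsAdaptedTower 𝒜 𝒬 perp P Q F c I T) (hI : IsLaminar I) (hfin : I.Finite) {i j : Set Ω}
    (hi : i ∈ I) (hj : j ∈ I) (hij : P (limitNode T i \ limitNode T j) = 0) : i ⊆ j := by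
  by_contra hn
  by_cases hji : j ⊆ i
  -- The child of i above j has a sibling; its limit node is non-null, lies in that of i and misses
  -- that of j.
  · obtain ⟨k, hk, hjk⟩ := hI.exists_child_superset hfin hj hi ⟨hji, hn⟩
    obtain ⟨k', hne, hk'⟩ := h.exists_sibling hk
    have hd := (h.disjoint_limitNode_of_isChild hbase hk hk' hne).mono_left
      (h.limitNode_subset_limitNode hj hk.mem hjk)
    refine (h.measure_limitNode_pos hbase hk'.mem).ne' (measure_mono_null ?_ hij)
    exact fun x hx => ⟨h.limitNode_subset_limitNode hk'.mem hi hk'.ssubset.1 hx,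
      fun hxj => disjoint_left.1 hd hxj hx⟩
  · rw [(h.disjoint_limitNode hbase hi hj hn hji).sdiff_eq_left] at hij
    exact (h.measure_limitNode_pos hbase hi).ne' hij

/-- The receiving set cannot change with n: the non-null node `T 0 i` would lie almost in two
disjoint sets. -/
theorem exists_measure_limitNode_diff (hbase : IsClusteringBase 𝒜 𝒬 perp)
    (h : IsAdaptedTower 𝒜 𝒬 perp P Q F c I T) {i : Set Ω} (hi : i ∈ I) {J : Set (Set Ω)}
    (hJ : J.PairwiseDisjoint (limitNode T'))
    (hex : ∀ n, ∃ j ∈ J, P (T n i \ limitNode T' j) = 0) :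
    ∃ j ∈ J, P (limitNode T i \ limitNode T' j) = 0 := by
  choose j hj hnull using hex
  have heq : ∀ n, j n = j 0 := by
    intro n
    by_contra hne
    refine (h.measure_pos hbase (h.mem hi 0)).ne' (measure_mono_null ?_
      (measure_union_null (hnull n) (hnull 0)))
    intro x hx
    by_cases hxn : x ∈ limitNode T' (j n)
    · exact Or.inr ⟨hx, disjoint_left.1 (hJ (hj n) (hj 0) hne) hxn⟩
    · exact Or.inl ⟨h.mono i hi (zero_le (a := n)) hx, hxn⟩
  refine ⟨j 0, hj 0, ?_⟩
  rw [limitNode, iUnion_sdiff]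
  exact measure_iUnion_null fun n => heq n ▸ hnull n

/-- At every stage i has a sibling below k, which supplies the second half of a motivated pair. -/
theorem exists_child_measure_diff [IsFiniteMeasure P] (hbase : IsClusteringBase 𝒜 𝒬 perp)
    (hsub : IsSubadditive 𝒜 𝒬 P) (h : IsAdaptedTower 𝒜 𝒬 perp P Q F c I T)
    (h' : IsAdaptedTower 𝒜 𝒬 perp P Q' F' c' I' T') (hI' : I'.Finite) {i k k' : Set Ω}
    (hi : IsChild I i k) (hk' : k' ∈ I') (hkk' : P (limitNode T k \ limitNode T' k') = 0) :
    ∃ j, IsChild I' j k' ∧ P (limitNode T i \ limitNode T' j) = 0 := by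
  obtain ⟨i₂, hne, hi₂⟩ := h.exists_sibling hi
  refine h.exists_measure_limitNode_diff hbase (J := {j | IsChild I' j k'}) hi.mem
    (fun j₁ hj₁ j₂ hj₂ hj => h'.disjoint_limitNode_of_isChild hbase hj₁ hj₂ hj) fun n => ?_
  have hs := (h.isChild hi n).directSiblings (h.isLaminar hbase n) (F n).finite_toSet
    (h.isChild hi₂ n) fun he => hne ((h.iso n).bijOn.injOn hi.mem hi₂.mem he)
  obtain ⟨t, hp⟩ := h.exists_isMotivatedPair hbase hs
  have hnull : ∀ e, IsChild I e k → P (T n e \ limitNode T' k') = 0 := fun e he =>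
    measure_mono_null (sdiff_subset_sdiff_left
      ((h.isChild he n).ssubset.1.trans (subset_limitNode T n k))) hkk'
  exact hp.exists_child_measure_diff hbase hsub h' hI' hk' (hnull i hi) (hnull i₂ hi₂)

/-! ### Matching roots, then all nodes by descent -/

theorem isRoot (h : IsAdaptedTower 𝒜 𝒬 perp P Q F c I T) {i : Set Ω} (hi : IsRoot I i) (n : ℕ) :
    IsRoot (F n : Set (Set Ω)) (T n i) :=
  (isRoot_struct_iff (F n).finite_toSet).1 (((h.iso n).isRoot_iff hi.1).1 hi)

theorem exists_isRoot_pos (hbase : IsClusteringBase 𝒜 𝒬 perp)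
    (h : IsAdaptedTower 𝒜 𝒬 perp P Q F c I T) {X : Set Ω} (hX : MeasurableSet X)
    (hpos : 0 < P X) : ∃ j, IsRoot I j ∧ 0 < P (X ∩ limitNode T j) := by
  obtain ⟨m, hm⟩ := ((h.tendsto X hX).eventually (lt_mem_nhds hpos)).exists
  obtain ⟨C, hC, hCpos⟩ := (h.rep m).exists_mem_pos hm
  obtain ⟨R, hR, hCR⟩ := IsLaminar.exists_root_superset (F m).finite_toSet hC
  obtain ⟨j, hj, rfl⟩ := (h.iso m).bijOn.surjOn hR.mem_struct
  refine ⟨j, ((h.iso m).isRoot_iff hj).2 ((isRoot_struct_iff (F m).finite_toSet).2 hR), ?_⟩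
  have hl := (h.rep m).isBaseMeasureOn_smul hC
  rw [← hl.measure_inter_of_le hbase le_rfl] at hCpos
  refine hCpos.trans_le ((((h.rep m).smul_le hC).trans (h.le m) _).trans (measure_mono ?_))
  exact inter_subset_inter_right _ (hCR.trans (subset_limitNode T m j))

/-- Merging b with both roots would make them kin below `P`, and groundedness would then give a root
a parent. -/
theorem isRoot_unique (hbase : IsClusteringBase 𝒜 𝒬 perp) (hsub : IsSubadditive 𝒜 𝒬 P)
    (h : IsAdaptedTower 𝒜 𝒬 perp P Q F c I T) {b : Measure Ω} {B : Set Ω}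
    (hb : IsBaseMeasureOn 𝒜 𝒬 b B) (hbP : b ≤ P) {j₁ j₂ : Set Ω} (hj₁ : IsRoot I j₁)
    (hj₂ : IsRoot I j₂) (hpos₁ : 0 < P (B ∩ limitNode T j₁))
    (hpos₂ : 0 < P (B ∩ limitNode T j₂)) : j₁ = j₂ := by
  by_contra hne
  obtain ⟨m, hm₁, hm₂⟩ := ((h.eventually_pos hj₁.1 hpos₁).and
    (h.eventually_pos hj₂.1 hpos₂)).exists
  have hr₁ := h.isRoot hj₁ m
  have hs := hr₁.directSiblings (h.isRoot hj₂ m)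
    fun he => hne ((h.iso m).bijOn.injOn hj₁.1 hj₂.1 he)
  obtain ⟨b₁, B₁, hb₁, hb₁P, hBB₁, hT₁, -⟩ := hsub.merge hb (h.isBaseMeasureOn_level hbase hs.1)
    hbP (h.level_le hbase hs.1) hm₁
  obtain ⟨b₂, B₂, hb₂, hb₂P, hB₁₂, hT₂, -⟩ := hsub.merge hb₁
    (h.isBaseMeasureOn_level hbase hs.2.1) hb₁P (h.level_le hbase hs.2.1)
    (hm₂.trans_le (measure_mono (inter_subset_inter_left _ hBB₁)))
  obtain ⟨E, hE, -⟩ := (h.adapted m _ _ hs).1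
    ⟨b₂, B₂, hb₂, union_subset (hT₁.trans hB₁₂) hT₂, hb₂P⟩
  exact hr₁.2 ⟨E, hE.1⟩

theorem exists_isRoot_measure_diff (hbase : IsClusteringBase 𝒜 𝒬 perp)
    (hsub : IsSubadditive 𝒜 𝒬 P) (h : IsAdaptedTower 𝒜 𝒬 perp P Q F c I T)
    (h' : IsAdaptedTower 𝒜 𝒬 perp P Q' F' c' I' T') {i : Set Ω} (hi : i ∈ I) :
    ∃ j, IsRoot I' j ∧ P (limitNode T i \ limitNode T' j) = 0 := by
  refine h.exists_measure_limitNode_diff hbase (J := {j | IsRoot I' j}) hi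
    (fun j₁ hj₁ j₂ hj₂ hj => ?_) fun n => ?_
  · exact h'.disjoint_limitNode hbase hj₁.1 hj₂.1
      (fun hs => hj₁.2 ⟨j₂, hj₂.1, hs.ssubset_of_ne hj⟩)
      (fun hs => hj₂.2 ⟨j₁, hj₁.1, hs.ssubset_of_ne hj.symm⟩)
  · have hK := h.mem hi n
    have hKm := h.measurableSet hbase hi n
    obtain ⟨j, hj, hpos⟩ := h'.exists_isRoot_pos hbase hKm (h.measure_pos hbase hK)
    refine ⟨j, hj, ?_⟩
    by_contra hne
    obtain ⟨j₂, hj₂, hpos₂⟩ := h'.exists_isRoot_pos hbase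
      (hKm.diff (h'.measurableSet_limitNode hbase hj.1)) (pos_iff_ne_zero.2 hne)
    have he := h'.isRoot_unique hbase hsub (h.isBaseMeasureOn_level hbase hK)
      (h.level_le hbase hK) hj₂ hj
      (hpos₂.trans_le (measure_mono (inter_subset_inter_left _ sdiff_subset))) hpos
    rw [he, sdiff_inter_self, measure_empty] at hpos₂
    exact lt_irrefl _ hpos₂

/-- Every limit node of one tower is, up to a `P`-null set, a limit node of the other. -/
theorem exists_limitNode_eq [IsFiniteMeasure P] (hbase : IsClusteringBase 𝒜 𝒬 perp)
    (hsub : IsSubadditive 𝒜 𝒬 P) (h : IsAdaptedTower 𝒜 𝒬 perp P Q F c I T)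
    (h' : IsAdaptedTower 𝒜 𝒬 perp P Q' F' c' I' T') (hI : IsLaminar I) (hfin : I.Finite)
    (hfin' : I'.Finite) {i : Set Ω} (hi : i ∈ I) :
    ∃ j ∈ I', P (limitNode T i \ limitNode T' j) = 0 ∧
      P (limitNode T' j \ limitNode T i) = 0 := by
  induction hN : (strictAncestors I i).ncard using Nat.strong_induction_on generalizing i with
  | _ N ih =>
  by_cases hr : IsRoot I i
  · obtain ⟨j, hj, hij⟩ := h.exists_isRoot_measure_diff hbase hsub h' hi
    obtain ⟨i₂, hi₂, hji₂⟩ := h'.exists_isRoot_measure_diff hbase hsub h hj.1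
    have hsubset := h.subset_of_measure_diff hbase hI hfin hi hi₂.1
      (measure_diff_null_trans hij hji₂)
    have he : i = i₂ := by
      by_contra hne
      exact hr.2 ⟨i₂, hi₂.1, hsubset.ssubset_of_ne hne⟩
    exact ⟨j, hj.1, hij, he ▸ hji₂⟩
  · obtain ⟨k, hk⟩ := hI.exists_parent hfin hi hr
    have hlt : (strictAncestors I k).ncard < N := by
      rw [← hN]
      refine ncard_lt_ncard ⟨fun E hE => ⟨hE.1, hk.ssubset.trans hE.2⟩, fun hs => ?_⟩
        (hfin.subset fun E hE => hE.1)
      exact (ssubset_irrefl k) (hs ⟨hk.parent_mem, hk.ssubset⟩).2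
    obtain ⟨k', hk', hkk', hk'k⟩ := ih _ hlt hk.parent_mem rfl
    obtain ⟨j, hj, hij⟩ := h.exists_child_measure_diff hbase hsub h' hfin' hk hk' hkk'
    obtain ⟨i₂, hi₂, hji₂⟩ :=
      h'.exists_child_measure_diff hbase hsub h hfin hj hk.parent_mem hk'k
    have hsubset := h.subset_of_measure_diff hbase hI hfin hi hi₂.mem
      (measure_diff_null_trans hij hji₂)
    -- Both are children of k, so neither can lie strictly inside the other.
    have he : i = i₂ := by
      by_contra hne
      exact hi₂.ssubset.2 (hk.le_of_ssubset i₂ hi₂.mem (hsubset.ssubset_of_ne hne))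
    exact ⟨j, hj.mem, hij, he ▸ hji₂⟩

/-! ### Limit forests: structure, separation and equality modulo null sets -/

theorem isForestIso_limitNode (hbase : IsClusteringBase 𝒜 𝒬 perp)
    (h : IsAdaptedTower 𝒜 𝒬 perp P Q F c I T) (hI : IsLaminar I) (hfin : I.Finite) :
    IsForestIso I (limitNode T '' I) (limitNode T) := by
  have key : ∀ i ∈ I, ∀ j ∈ I, limitNode T i ⊆ limitNode T j → i ⊆ j := fun i hi j hj hs =>
    h.subset_of_measure_diff hbase hI hfin hi hj (by rw [sdiff_eq_empty.2 hs, measure_empty])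
  refine ⟨⟨mapsTo_image _ _, fun i hi j hj he => ?_, surjOn_image _ _⟩, fun i hi j hj =>
    ⟨h.limitNode_subset_limitNode hi hj, key i hi j hj⟩⟩
  exact (key i hi j hj he.subset).antisymm (key j hj i hi he.symm.subset)

/-- Nodes of different stages are compared at a common later stage; stability is then applied once
in each argument. -/
theorem perp_limitNode (hbase : IsClusteringBase 𝒜 𝒬 perp) (hstable : IsStable 𝒜 perp)
    (h : IsAdaptedTower 𝒜 𝒬 perp P Q F c I T) {i j : Set Ω} (hi : i ∈ I) (hj : j ∈ I)
    (hij : ¬ i ⊆ j) (hji : ¬ j ⊆ i) : perp (limitNode T i) (limitNode T j) := by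
  have hsep := hbase.separation
  have hm := fun n => h.measurableSet hbase hi n
  have hm' := fun n => h.measurableSet hbase hj n
  have hnode : ∀ n m, perp (T n i) (T m j) := by
    intro n m
    have hp : perp (T (max n m) i) (T (max n m) j) := by
      rcases (h.rep (max n m)).forest.separated _ (h.mem hi _) _ (h.mem hj _) with h' | h' | h'
      · exact h'
      · exact absurd (((h.iso _).subset_iff i hi j hj).2 h') hij
      · exact absurd (((h.iso _).subset_iff j hj i hi).2 h') hji
    have h₁ := hsep.monotonicity _ _ _ (hm n) (hm _) (hm' _) (h.mono i hi (le_max_left n m)) hp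
    exact hsep.symm _ _ (hm' m) (hm n) (hsep.monotonicity _ _ _ (hm' m) (hm' _) (hm n)
      (h.mono j hj (le_max_right n m)) (hsep.symm _ _ (hm n) (hm' _) h₁))
  have hlim : ∀ m, perp (limitNode T i) (T m j) := fun m =>
    hstable (fun n => T n i) (fun n => h.mem_base (h.mem hi n))
      (fun n => h.mono i hi n.le_succ) _ (hm' m) fun n => hnode n m
  have hmi := h.measurableSet_limitNode hbase hi
  refine hsep.symm _ _ (h.measurableSet_limitNode hbase hj) hmi ?_
  exact hstable (fun n => T n j) (fun n => h.mem_base (h.mem hj n))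
    (fun n => h.mono j hj n.le_succ) _ hmi fun n => hsep.symm _ _ hmi (hm' n) (hlim n)

theorem isFiniteStructuredForest (hbase : IsClusteringBase 𝒜 𝒬 perp) (hstable : IsStable 𝒜 perp)
    (h : IsAdaptedTower 𝒜 𝒬 perp P Q F c I T) (hI : IsLaminar I) (hfin : I.Finite)
    (hne : I.Nonempty) (hstruct : struct I = I) :
    IsFiniteStructuredForest perp (limitNode T '' I) := by
  refine ⟨hfin.image _, ⟨hne.image _, ?_, ?_⟩,
    (h.isForestIso_limitNode hbase hI hfin).struct_eq hstruct⟩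
  · rintro _ ⟨i, hi, rfl⟩
    exact ⟨h.measurableSet_limitNode hbase hi,
      nonempty_of_measure_ne_zero (h.measure_limitNode_pos hbase hi).ne'⟩
  · rintro _ ⟨i, hi, rfl⟩ _ ⟨j, hj, rfl⟩
    by_cases hij : i ⊆ j
    · exact Or.inr (Or.inl (h.limitNode_subset_limitNode hi hj hij))
    by_cases hji : j ⊆ i
    · exact Or.inr (Or.inr (h.limitNode_subset_limitNode hj hi hji))
    exact Or.inl (h.perp_limitNode hbase hstable hi hj hij hji)

end IsAdaptedTower

/-- Since almost inclusion is inclusion within each family, partners are unique, and any choice of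
them preserves and reflects inclusion. -/
theorem forestEq_of_exists {G G' : Set (Set Ω)}
    (hG : ∀ A ∈ G, ∀ B ∈ G, P (A \ B) = 0 → A ⊆ B)
    (hG' : ∀ A ∈ G', ∀ B ∈ G', P (A \ B) = 0 → A ⊆ B)
    (hex : ∀ A ∈ G, ∃ A' ∈ G', P (A \ A') = 0 ∧ P (A' \ A) = 0)
    (hex' : ∀ A' ∈ G', ∃ A ∈ G, P (A' \ A) = 0 ∧ P (A \ A') = 0) : ForestEq P G G' := by
  have hex₂ : ∀ A, ∃ A', A ∈ G → A' ∈ G' ∧ P (A \ A') = 0 ∧ P (A' \ A) = 0 := fun A => by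
    by_cases hA : A ∈ G
    · obtain ⟨A', h⟩ := hex A hA
      exact ⟨A', fun _ => h⟩
    · exact ⟨A, fun h => absurd h hA⟩
  choose ζ hζ using hex₂
  have hsub : ∀ A ∈ G, ∀ B ∈ G, A ⊆ B ↔ ζ A ⊆ ζ B := by
    intro A hA B hB
    obtain ⟨hA', h₁, h₂⟩ := hζ A hA
    obtain ⟨hB', h₃, h₄⟩ := hζ B hB
    constructor
    · intro hs
      refine hG' _ hA' _ hB' (measure_diff_null_trans h₂ (measure_diff_null_trans ?_ h₃))
      rw [sdiff_eq_empty.2 hs, measure_empty]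
    · intro hs
      refine hG A hA B hB (measure_diff_null_trans h₁ (measure_diff_null_trans ?_ h₄))
      rw [sdiff_eq_empty.2 hs, measure_empty]
  refine ⟨ζ, ⟨⟨fun A hA => (hζ A hA).1, fun A hA B hB he => ?_, fun A' hA' => ?_⟩, hsub⟩,
    fun A hA => ?_⟩
  · exact ((hsub A hA B hB).2 he.subset).antisymm ((hsub B hB A hA).2 he.symm.subset)
  · obtain ⟨A, hA, h₁, h₂⟩ := hex' A' hA'
    obtain ⟨hζA, h₃, h₄⟩ := hζ A hA
    exact ⟨A, hA, (hG' _ hζA _ hA' (measure_diff_null_trans h₄ h₂)).antisymm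
      (hG' _ hA' _ hζA (measure_diff_null_trans h₁ h₃))⟩
  · exact measure_union_null (hζ A hA).2.1 (hζ A hA).2.2

theorem IsAdaptedTower.forestEq [IsFiniteMeasure P] (hbase : IsClusteringBase 𝒜 𝒬 perp)
    (hsub : IsSubadditive 𝒜 𝒬 P) (h : IsAdaptedTower 𝒜 𝒬 perp P Q F c I T)
    (h' : IsAdaptedTower 𝒜 𝒬 perp P Q' F' c' I' T') (hI : IsLaminar I) (hfin : I.Finite)
    (hI' : IsLaminar I') (hfin' : I'.Finite) :
    ForestEq P (limitNode T '' I) (limitNode T' '' I') := by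
  refine forestEq_of_exists ?_ ?_ ?_ ?_
  · rintro _ ⟨i, hi, rfl⟩ _ ⟨j, hj, rfl⟩ h0
    exact h.limitNode_subset_limitNode hi hj (h.subset_of_measure_diff hbase hI hfin hi hj h0)
  · rintro _ ⟨i, hi, rfl⟩ _ ⟨j, hj, rfl⟩ h0
    exact h'.limitNode_subset_limitNode hi hj
      (h'.subset_of_measure_diff hbase hI' hfin' hi hj h0)
  · rintro _ ⟨i, hi, rfl⟩
    obtain ⟨j, hj, h₁, h₂⟩ := h.exists_limitNode_eq hbase hsub h' hI hfin hfin' hi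
    exact ⟨_, mem_image_of_mem _ hj, h₁, h₂⟩
  · rintro _ ⟨i, hi, rfl⟩
    obtain ⟨j, hj, h₁, h₂⟩ := h'.exists_limitNode_eq hbase hsub h hI' hfin' hfin hi
    exact ⟨_, mem_image_of_mem _ hj, h₁, h₂⟩

theorem struct_nonempty {G : Set (Set Ω)} (hfin : G.Finite) (hne : G.Nonempty) :
    (struct G).Nonempty := by
  obtain ⟨A, hA⟩ := hne
  obtain ⟨R, hR, -⟩ := IsLaminar.exists_root_superset hfin hA
  exact ⟨R, hR.mem_struct⟩

theorem AdaptedIsomonotoneConv.exists_isAdaptedTower (hbase : IsClusteringBase 𝒜 𝒬 perp)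
    (hQ : AdaptedIsomonotoneConv 𝒜 𝒬 perp Q F P) :
    ∃ c T, IsAdaptedTower 𝒜 𝒬 perp P Q F c (struct (F 0 : Set (Set Ω))) T ∧
      limitForest (fun n => (F n : Set (Set Ω))) =
        limitNode T '' struct (F 0 : Set (Set Ω)) := by
  -- Representation and adaptedness come with the same coefficients, so the strictly motivated
  -- levels are those of this representation.
  choose c hc using hQ.2
  have hlam : ∀ n, IsLaminar (struct (F n : Set (Set Ω))) := fun n =>
    ((hc n).1.forest.isLaminar hbase.separation).mono (struct_subset _)
  refine ⟨c, fun n => frm (struct (F 0 : Set (Set Ω))) (struct (F n : Set (Set Ω))),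
    ⟨fun n => (hc n).1, fun n => (hc n).2, hQ.1.le, hQ.1.tendsto, fun n => ?_, fun i hi => ?_⟩, ?_⟩
  · exact (forestLE_of_succ (G := fun n => struct (F n : Set (Set Ω)))
      hQ.1.struct_le n).isFRM_frm.toIsForestIso
  · exact monotone_nat_of_le_succ fun n =>
      frm_subset_frm_succ hlam ((F 0).finite_toSet.subset (struct_subset _)) hQ.1.struct_le hi n
  · ext B
    exact ⟨fun ⟨A, hA, hB⟩ => ⟨A, hA, hB.symm⟩, fun ⟨A, hA, hB⟩ => ⟨A, hA, hB.symm⟩⟩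

end Comparison

end Clustering
end

theorem mainTheorem1 {Ω : Type*} [TopologicalSpace Ω] [T2Space Ω] [MeasurableSpace Ω]
    [OpensMeasurableSpace Ω]
    (𝒜 : Set (Set Ω)) (𝒬 : Set Ω → Measure Ω) (perp : Set Ω → Set Ω → Prop)
    (hbase : IsClusteringBase 𝒜 𝒬 perp) (hstable : IsStable 𝒜 perp)
    (P : Measure Ω) (hP : MemM P) (hsub : IsSubadditive 𝒜 𝒬 P)
    (Q Q' : ℕ → Measure Ω) (F F' : ℕ → Finset (Set Ω))
    (hQ : AdaptedIsomonotoneConv 𝒜 𝒬 perp Q F P)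
    (hQ' : AdaptedIsomonotoneConv 𝒜 𝒬 perp Q' F' P) :
    IsFiniteStructuredForest perp (limitForest fun n => (F n : Set (Set Ω))) ∧
    IsFiniteStructuredForest perp (limitForest fun n => (F' n : Set (Set Ω))) ∧
    ForestEq P (limitForest fun n => (F n : Set (Set Ω)))
      (limitForest fun n => (F' n : Set (Set Ω))) := by
  have := hP.finite
  obtain ⟨c, T, h, hlim⟩ := hQ.exists_isAdaptedTower hbase
  obtain ⟨c', T', h', hlim'⟩ := hQ'.exists_isAdaptedTower hbase
  have hI := (h.isLaminar hbase 0).mono (struct_subset _)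
  have hI' := (h'.isLaminar hbase 0).mono (struct_subset _)
  have hfin := (F 0).finite_toSet.subset (struct_subset _)
  have hfin' := (F' 0).finite_toSet.subset (struct_subset _)
  rw [hlim, hlim']
  exact ⟨h.isFiniteStructuredForest hbase hstable hI hfin
      (struct_nonempty (F 0).finite_toSet (h.rep 0).forest.nonempty) (struct_struct _),
    h'.isFiniteStructuredForest hbase hstable hI' hfin'
      (struct_nonempty (F' 0).finite_toSet (h'.rep 0).forest.nonempty) (struct_struct _),
    h.forestEq hbase hsub h' hI hfin hI' hfin'⟩
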